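/- Let $n\ge 3$, $\mu\in\mathbb R^n$, $\sigma>0$, and let $Y_i=\mu_i+\sigma\varepsilon_i$, $i=1,\dots,n$, where $\varepsilon_1,\dots,\varepsilon_n$ are i.i.d. standard Gaussian random variables. Let $\{\mathcal S_m,\ m\in\mathcal M\}$ be a finite collection of linear subspaces of $\mathbb R^n$, all contained in a linear subspace $\mathcal S_*\subset\mathbb R^n$ of dimension $d_*<n$; put $N_*=n-d_*$. Let $\{\pi_m,\ m\in\mathcal M\}$ be a probability distribution on $\mathcal M$, let $\{L_m,\ m\in\mathcal M\}$ be non-negative numbers and $\beta>0$. Write $\Pi_{\mathcal S}$ for the orthogonal projector onto $\mathcal S$ and $\|\cdot\|$ for the Euclidean norm, and set $$\hat\mu_m=\Pi_{\mathcal S_m}Y,\qquad \hat\sigma^2=\frac{\|Y-\Pi_{\mathcal S_*}Y\|^2}{N_*},\qquad \hat\mu=\sum_{m\in\mathcal M}w_m\hat\mu_m,\qquad w_m=\frac{\pi_m}{\mathcal Z}\exp\left(\beta\frac{\|\hat\mu_m\|^2}{\hat\sigma^2}-L_m\right),$$ where $\mathcal Z$ normalizes the sum of the $w_m$ to one. Let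 $\phi(x)=(x-1-\log x)/2$ for $x\in(0,1)$. Assume that $$\beta<\tfrac14,\qquad N_*\ge 2+\frac{\log n}{\phi(4\beta)},\qquad L_m\ge \tfrac12\dim(\mathcal S_m)\ \text{ for all } m\in\mathcal M.$$ Then $\|\mu-\hat\mu\|^2$ is integrable and $$\begin{aligned}\mathbb E\left[\|\mu-\hat\mu\|^2\right]&\le -(1+\varepsilon_n)\frac{\bar\sigma^2}{\beta}\log\left[\sum_{m\in\mathcal M}\pi_m\exp\left(-\frac{\beta\left[\|\mu-\Pi_{\mathcal S_m}\mu\|^2-\dim(\mathcal S_m)\sigma^2\right]}{\bar\sigma^2}-L_m\right)\right]+\frac{\sigma^2}{2\log n}\\&\le(1+\varepsilon_n)\inf_{m\in\mathcal M}\left\{\|\mu-\Pi_{\mathcal S_m}\mu\|^2+\frac{\bar\sigma^2}{\beta}\left(L_m-\log\pi_m\right)\right\}+\frac{\sigma^2}{2\log n},\end{aligned}$$ where $\varepsilon_n=(2n\log n)^{-1}$, $\bar\sigma^2=\sigma^2+\|\mu-\Pi_{\mathcal S_*}\mu\|^2/N_*$, and $-\log 0=+\infty$ (so models with $\pi_m=0$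 do not contribute to the infimum). -/

import Mathlib

open MeasureTheory ProbabilityTheory

namespace GibbsMixing

/-- `ℝⁿ` with the Euclidean norm. -/
abbrev Vec (n : ℕ) : Type := EuclideanSpace ℝ (Fin n)

/-- The function `φ(x) = (x - 1 - log x) / 2`, used on `(0, 1)`. -/
noncomputable def phi (x : ℝ) : ℝ := (x - 1 - Real.log x) / 2

/-- The observation `Y = μ + σ e` with noise vector `e`. -/
noncomputable def observation {n : ℕ} (μ : Vec n) (σ : ℝ) (e : Fin n → ℝ) : Vec n :=
  WithLp.toLp 2 (fun i => μ i + σ * e i)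

/-- The residual dimension `N_* = n - dim S_*`, as a real number. -/
noncomputable def residualDim {n : ℕ} (Sstar : Submodule ℝ (Vec n)) : ℝ :=
  (n : ℝ) - (Module.finrank ℝ Sstar : ℝ)

/-- The least-squares estimator on the model `S`: the orthogonal projection of `y` onto `S`. -/
noncomputable def leastSquares {n : ℕ} (S : Submodule ℝ (Vec n)) (y : Vec n) : Vec n :=
  S.starProjection y

/-- The residual variance estimator `‖y - Π_{S_*} y‖² / N_*`. -/
noncomputable def varianceEstimator {n : ℕ} (Sstar : Submodule ℝ (Vec n)) (y : Vec n) : ℝ :=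
  ‖y - Sstar.starProjection y‖ ^ 2 / residualDim Sstar

section Estimator

variable {n : ℕ} {M : Type*} [Fintype M]

/-- The weight of the model `m` before normalization:
`π_m exp (β ‖μ̂_m‖² / σ̂² - L_m)`. -/
noncomputable def rawWeight (S : M → Submodule ℝ (Vec n)) (Sstar : Submodule ℝ (Vec n))
    (π L : M → ℝ) (β : ℝ) (y : Vec n) (m : M) : ℝ :=
  π m * Real.exp (β * ‖leastSquares (S m) y‖ ^ 2 / varianceEstimator Sstar y - L m)

/-- The normalized weight `w_m`. -/
noncomputable def weight (S : M → Submodule ℝ (Vec n)) (Sstar : Submodule ℝ (Vec n))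
    (π L : M → ℝ) (β : ℝ) (y : Vec n) (m : M) : ℝ :=
  rawWeight S Sstar π L β y m / ∑ k, rawWeight S Sstar π L β y k

/-- The mixed estimator `μ̂ = ∑ w_m μ̂_m`. -/
noncomputable def mixedEstimator (S : M → Submodule ℝ (Vec n)) (Sstar : Submodule ℝ (Vec n))
    (π L : M → ℝ) (β : ℝ) (y : Vec n) : Vec n :=
  ∑ m, weight S Sstar π L β y m • leastSquares (S m) y

/-- `σ̄² = σ² + ‖μ - Π_{S_*} μ‖² / N_*`. -/
noncomputable def sigmaBarSq (Sstar : Submodule ℝ (Vec n)) (μ : Vec n) (σ : ℝ) : ℝ :=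
  σ ^ 2 + ‖μ - Sstar.starProjection μ‖ ^ 2 / residualDim Sstar

/-- `ε_n = (2 n log n)⁻¹`. -/
noncomputable def epsilonN (n : ℕ) : ℝ := (2 * (n : ℝ) * Real.log n)⁻¹

/-- The Gibbs-type risk bound. -/
noncomputable def gibbsBound (S : M → Submodule ℝ (Vec n)) (Sstar : Submodule ℝ (Vec n))
    (π L : M → ℝ) (β : ℝ) (μ : Vec n) (σ : ℝ) : ℝ :=
  -(1 + epsilonN n) * (sigmaBarSq Sstar μ σ / β) *
      Real.log (∑ m, π m * Real.exp
        (-β * (‖μ - (S m).starProjection μ‖ ^ 2 - (Module.finrank ℝ (S m) : ℝ) * σ ^ 2)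
            / sigmaBarSq Sstar μ σ - L m))
    + σ ^ 2 / (2 * Real.log n)

/-- The oracle risk bound. Models with `π_m = 0` have `-log π_m = +∞` and so do not contribute to
the infimum, which is therefore taken over the models with `π_m > 0`. -/
noncomputable def oracleBound (S : M → Submodule ℝ (Vec n)) (Sstar : Submodule ℝ (Vec n))
    (π L : M → ℝ) (β : ℝ) (μ : Vec n) (σ : ℝ) : ℝ :=
  (1 + epsilonN n) *
      (⨅ m : {m : M // 0 < π m}, (‖μ - (S m).starProjection μ‖ ^ 2
        + sigmaBarSq Sstar μ σ / β * (L m - Real.log (π m))))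
    + σ ^ 2 / (2 * Real.log n)

end Estimator

end GibbsMixing

/-! Split the space as `Sstar` plus its orthogonal complement. The Gaussian noise splits into
independent standard Gaussian parts x and u (`stdGaussian_eq_map_prod`). Every projection in the
mixture sees only x, and the variance estimate s sees only u, so for fixed u the estimator is a
Gibbs mixture inside `Sstar` with deterministic inverse temperature b = β/s (`mixedEstimator_add`).

For fixed b, Stein's identity rewrites the risk as the expectation of R + (4bσ² - 1)V + 2σ² ∑ w dim,
up to a constant. Here R is the averaged squared residual and V the dispersion of the projections
under the weights w. Since 0 ≤ V ≤ R and L ≥ dim/2, this is at most κ/b times the w-average of the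
energy q = b‖residual‖² + L, with κ = max(1, 4bσ²). That average is at most the free energy -log
Z(q). The free energy is concave, so it lies below its tangent at any deterministic energy r, and
the tangent is affine in the squared residuals, whose means are explicit (`sure_le`,
`integral_norm_sub_gibbsMixture_sq_le`).

Now take r to be the energy at the mean squared residuals and at temperature β/t, with t = σ̄² = E
s. On integrating over u the linear correction averages to zero, and the price of a random
temperature is the factor 1 + E(4βσ²/s - 1)₊ (`free_energy_scaling`). A Chernoff bound for
noncentral chi-square variables and the lower bound on N_* make this expectation at most ε_n. The
oracle bound follows by keeping one term of the sum inside the logarithm. -/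

namespace GibbsMixing

/-! ### Gaussian calculus: density, Stein's identity, Laplace transform, orthogonal splitting. -/

section StdGaussian

variable {E : Type*} [NormedAddCommGroup E] [InnerProductSpace ℝ E]

/-- The density of the standard Gaussian measure on a Euclidean space. -/
noncomputable def gaussianDensity (E : Type*) [NormedAddCommGroup E] [InnerProductSpace ℝ E]
    (x : E) : ℝ :=
  (2 * Real.pi) ^ (-(Module.finrank ℝ E / 2 : ℝ)) * Real.exp (-(1 / 2) * ‖x‖ ^ 2)

lemma gaussianDensity_nonneg (x : E) : 0 ≤ gaussianDensity E x := by
  unfold gaussianDensity; positivity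

lemma continuous_gaussianDensity : Continuous (gaussianDensity E) := by
  unfold gaussianDensity; fun_prop

lemma hasFDerivAt_gaussianDensity (x : E) :
    HasFDerivAt (gaussianDensity E) (-(gaussianDensity E x) • innerSL ℝ x) x := by
  have h := (((hasFDerivAt_id x).norm_sq.const_mul (-(1 / 2) : ℝ)).exp).const_mul
    ((2 * Real.pi) ^ (-(Module.finrank ℝ E / 2 : ℝ)))
  refine h.congr_fderiv ?_
  ext v
  simp [gaussianDensity]
  ring

variable [FiniteDimensional ℝ E]

lemma trace_starProjection (T : Submodule ℝ E) :
    LinearMap.trace ℝ E T.starProjection.toLinearMap = Module.finrank ℝ T := by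
  refine LinearMap.IsProj.trace (p := T) ⟨fun x => ?_, fun x hx => ?_⟩
  · exact Submodule.starProjection_apply_mem T x
  · exact Submodule.starProjection_eq_self_iff.2 hx

variable [MeasurableSpace E] [BorelSpace E]

lemma integrable_exp_neg_mul_norm_sq {b : ℝ} (hb : 0 < b) :
    Integrable (fun x : E => Real.exp (-b * ‖x‖ ^ 2)) := by
  have h := (GaussianFourier.integrable_cexp_neg_mul_sq_norm_add (b := b) (V := E)
    (by simpa using hb) 0 0).norm
  refine h.congr (Filter.Eventually.of_forall fun x => ?_)
  simp only [Complex.norm_exp]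
  congr 1
  norm_cast
  simp

lemma integrable_gaussianDensity : Integrable (gaussianDensity E) :=
  (integrable_exp_neg_mul_norm_sq (by norm_num : (0 : ℝ) < 1 / 2)).const_mul _

/-- The characteristic functions agree. The density form gives access to integration by parts and to
translation invariance of Lebesgue measure. -/
lemma stdGaussian_eq_withDensity :
    stdGaussian E = volume.withDensity (fun x => ENNReal.ofReal (gaussianDensity E x)) := by
  have hfin : IsFiniteMeasure
      ((volume : Measure E).withDensity (fun x => ENNReal.ofReal (gaussianDensity E x))) :=
    isFiniteMeasure_withDensity_ofReal integrable_gaussianDensity.2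
  apply Measure.ext_of_charFun
  ext t
  rw [charFun_stdGaussian, charFun_apply,
    integral_withDensity_eq_integral_toReal_smul
      (continuous_gaussianDensity.measurable.ennreal_ofReal)
      (Filter.Eventually.of_forall fun _ => ENNReal.ofReal_lt_top)]
  have h := GaussianFourier.integral_cexp_neg_mul_sq_norm_add (b := 1 / 2) (V := E)
    (by norm_num) Complex.I t
  have hc : ((Real.pi : ℂ) / (1 / 2)) ^ (Module.finrank ℝ E / 2 : ℂ)
      = (((2 * Real.pi) ^ (Module.finrank ℝ E / 2 : ℝ) : ℝ) : ℂ) := by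
    rw [Complex.ofReal_cpow (by positivity)]
    push_cast
    congr 1
    ring
  rw [hc] at h
  have h2 : ∀ x : E, (ENNReal.ofReal (gaussianDensity E x)).toReal •
      Complex.exp (inner ℝ x t * Complex.I)
      = (((2 * Real.pi) ^ (-(Module.finrank ℝ E / 2 : ℝ)) : ℝ) : ℂ) *
        Complex.exp (-(1 / 2) * ‖x‖ ^ 2 + Complex.I * inner ℝ t x) := by
    intro x
    rw [ENNReal.toReal_ofReal (gaussianDensity_nonneg x), gaussianDensity, Complex.exp_add,
      Complex.real_smul, real_inner_comm]
    push_cast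
    rw [mul_comm Complex.I]
    ring
  simp_rw [h2]
  rw [integral_const_mul, h, ← mul_assoc, ← Complex.ofReal_mul, ← Real.rpow_add (by positivity)]
  simp only [neg_add_cancel, Real.rpow_zero, Complex.ofReal_one, one_mul, Complex.I_sq]
  congr 1
  ring

lemma integral_stdGaussian_eq {F : Type*} [NormedAddCommGroup F] [NormedSpace ℝ F] (f : E → F) :
    ∫ x, f x ∂(stdGaussian E) = ∫ x, gaussianDensity E x • f x := by
  rw [stdGaussian_eq_withDensity, integral_withDensity_eq_integral_toReal_smul
      (continuous_gaussianDensity.measurable.ennreal_ofReal)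
      (Filter.Eventually.of_forall fun _ => ENNReal.ofReal_lt_top)]
  simp_rw [ENNReal.toReal_ofReal (gaussianDensity_nonneg _)]

lemma integrable_stdGaussian_iff {f : E → ℝ} :
    Integrable f (stdGaussian E) ↔ Integrable (fun x => gaussianDensity E x * f x) := by
  rw [stdGaussian_eq_withDensity, integrable_withDensity_iff_integrable_smul'
      (continuous_gaussianDensity.measurable.ennreal_ofReal)
      (Filter.Eventually.of_forall fun _ => ENNReal.ofReal_lt_top)]
  simp_rw [ENNReal.toReal_ofReal (gaussianDensity_nonneg _), smul_eq_mul]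

lemma integrable_norm_pow_stdGaussian (k : ℕ) :
    Integrable (fun x : E => ‖x‖ ^ k) (stdGaussian E) :=
  (IsGaussian.memLp_id (stdGaussian E) k (by simp)).integrable_norm_pow'

/-- Functions of polynomial growth are integrable with respect to the standard Gaussian measure. -/
lemma integrable_stdGaussian_of_norm_le {F : Type*} [NormedAddCommGroup F] {f : E → F}
    (hf : AEStronglyMeasurable f (stdGaussian E)) (C : ℝ) (k : ℕ)
    (h : ∀ x, ‖f x‖ ≤ C * (1 + ‖x‖ ^ k)) : Integrable f (stdGaussian E) := by
  refine Integrable.mono' (g := fun x => C * (1 + ‖x‖ ^ k)) ?_ hf (Filter.Eventually.of_forall h)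
  exact ((integrable_const 1).add (integrable_norm_pow_stdGaussian k)).const_mul C

/-- Gaussian integration by parts in the direction `v`. -/
lemma integral_inner_mul_stdGaussian {f : E → ℝ} (hf : Differentiable ℝ f) (v : E)
    (h0 : Integrable f (stdGaussian E))
    (h1 : Integrable (fun x => inner ℝ x v * f x) (stdGaussian E))
    (h2 : Integrable (fun x => fderiv ℝ f x v) (stdGaussian E)) :
    ∫ x, inner ℝ x v * f x ∂(stdGaussian E) = ∫ x, fderiv ℝ f x v ∂(stdGaussian E) := by
  have hd : ∀ x : E, fderiv ℝ (gaussianDensity E) x v = -gaussianDensity E x * inner ℝ x v := by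
    intro x
    rw [(hasFDerivAt_gaussianDensity x).fderiv]
    simp
  have := integral_mul_fderiv_eq_neg_fderiv_mul_of_integrable (μ := (volume : Measure E))
    (f := gaussianDensity E) (g := f) (v := v)
    (by
      refine (integrable_stdGaussian_iff.1 h1).neg.congr (Filter.Eventually.of_forall fun x => ?_)
      simp only [hd, Pi.neg_apply]; ring)
    (integrable_stdGaussian_iff.1 h2) (integrable_stdGaussian_iff.1 h0)
    (fun x _ => (hasFDerivAt_gaussianDensity x).differentiableAt) (fun x _ => hf x)
  rw [integral_stdGaussian_eq, integral_stdGaussian_eq]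
  simp_rw [smul_eq_mul]
  rw [this, ← integral_neg]
  congr 1
  ext x
  rw [hd]
  ring

/-- Stein's identity for vector fields of polynomial growth. -/
lemma integral_inner_stdGaussian_eq_trace {h : E → E} {h' : E → E →L[ℝ] E}
    (hh : ∀ x, HasFDerivAt h (h' x) x) (C : ℝ) (k : ℕ)
    (hC : ∀ x, ‖h x‖ ≤ C * (1 + ‖x‖ ^ k)) (hC' : ∀ x, ‖h' x‖ ≤ C * (1 + ‖x‖ ^ k)) :
    Integrable (fun x => inner ℝ x (h x)) (stdGaussian E) ∧
    Integrable (fun x => LinearMap.trace ℝ E (h' x)) (stdGaussian E) ∧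
    ∫ x, inner ℝ x (h x) ∂(stdGaussian E)
      = ∫ x, LinearMap.trace ℝ E (h' x) ∂(stdGaussian E) := by
  have hdiff : Differentiable ℝ h := fun x => (hh x).differentiableAt
  have hh'eq : h' = fderiv ℝ h := by ext1 x; exact ((hh x).fderiv).symm
  -- Continuity of the derivative is not assumed; measurability is automatic for a Fréchet
  -- derivative.
  have hh'm : Measurable h' := hh'eq ▸ measurable_fderiv ℝ h
  set b := stdOrthonormalBasis ℝ E
  have hcomp : ∀ i x, HasFDerivAt (fun x => inner ℝ (b i) (h x))
      ((innerSL ℝ (b i)).comp (h' x)) x := fun i x =>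
    (innerSL ℝ (b i)).hasFDerivAt.comp x (hh x)
  have hhi : Integrable h (stdGaussian E) :=
    integrable_stdGaussian_of_norm_le hdiff.continuous.aestronglyMeasurable C k hC
  have hh'i : Integrable h' (stdGaussian E) :=
    integrable_stdGaussian_of_norm_le hh'm.aestronglyMeasurable C k hC'
  have hxh : Integrable (fun x => ‖x‖ * ‖h x‖) (stdGaussian E) := by
    refine Integrable.mono' (g := fun x => C * (‖x‖ ^ 1 + ‖x‖ ^ (k + 1))) ?_ ?_
      (Filter.Eventually.of_forall fun x => ?_)
    · exact ((integrable_norm_pow_stdGaussian 1).add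
        (integrable_norm_pow_stdGaussian (k + 1))).const_mul C
    · exact (continuous_norm.mul hdiff.continuous.norm).aestronglyMeasurable
    · rw [Real.norm_of_nonneg (by positivity)]
      calc ‖x‖ * ‖h x‖ ≤ ‖x‖ * (C * (1 + ‖x‖ ^ k)) := by gcongr; exact hC x
        _ = _ := by ring
  have key : ∀ i, Integrable (fun x => inner ℝ x (b i) * inner ℝ (b i) (h x)) (stdGaussian E) ∧
      Integrable (fun x => inner ℝ (b i) (h' x (b i))) (stdGaussian E) ∧
      ∫ x, inner ℝ x (b i) * inner ℝ (b i) (h x) ∂(stdGaussian E)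
        = ∫ x, inner ℝ (b i) (h' x (b i)) ∂(stdGaussian E) := by
    intro i
    have i1 : Integrable (fun x => inner ℝ x (b i) * inner ℝ (b i) (h x)) (stdGaussian E) := by
      refine hxh.mono' ?_ (Filter.Eventually.of_forall fun x => ?_)
      · have := hdiff.continuous
        exact Continuous.aestronglyMeasurable (by fun_prop)
      · rw [norm_mul]
        have e1 := norm_inner_le_norm (𝕜 := ℝ) x (b i)
        have e2 := norm_inner_le_norm (𝕜 := ℝ) (b i) (h x)
        rw [b.norm_eq_one, mul_one] at e1
        rw [b.norm_eq_one, one_mul] at e2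
        gcongr
    have i2 : Integrable (fun x => inner ℝ (b i) (h' x (b i))) (stdGaussian E) :=
      ((innerSL ℝ (b i)).comp (ContinuousLinearMap.apply ℝ E (b i))).integrable_comp hh'i
    have i0 : Integrable (fun x => inner ℝ (b i) (h x)) (stdGaussian E) :=
      (innerSL ℝ (b i)).integrable_comp hhi
    have hfd : ∀ x, fderiv ℝ (fun x => inner ℝ (b i) (h x)) x (b i)
        = inner ℝ (b i) (h' x (b i)) := fun x => by
      rw [(hcomp i x).fderiv]; rfl
    refine ⟨i1, i2, ?_⟩
    have := integral_inner_mul_stdGaussian (f := fun x => inner ℝ (b i) (h x))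
      (fun x => (hcomp i x).differentiableAt) (b i) i0 i1 (by simpa only [hfd] using i2)
    simpa only [hfd] using this
  -- In an orthonormal basis both sides become sums of the directional identities `key`.
  have e1 : ∀ x, inner ℝ x (h x) = ∑ i, inner ℝ x (b i) * inner ℝ (b i) (h x) := fun x =>
    (b.sum_inner_mul_inner x (h x)).symm
  have e2 : ∀ x, LinearMap.trace ℝ E (h' x) = ∑ i, inner ℝ (b i) (h' x (b i)) := fun x =>
    LinearMap.trace_eq_sum_inner _ b
  simp_rw [e1, e2]
  refine ⟨integrable_finsetSum _ fun i _ => (key i).1, integrable_finsetSum _ fun i _ =>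
    (key i).2.1, ?_⟩
  rw [integral_finsetSum _ fun i _ => (key i).1, integral_finsetSum _ fun i _ => (key i).2.1]
  exact Finset.sum_congr rfl fun i _ => (key i).2.2

lemma integral_inner_const_stdGaussian (u : E) : ∫ x, inner ℝ u x ∂(stdGaussian E) = 0 :=
  integral_strongDual_stdGaussian (innerSL ℝ u)

lemma integral_inner_apply_stdGaussian (A : E →L[ℝ] E) :
    ∫ x, inner ℝ x (A x) ∂(stdGaussian E) = LinearMap.trace ℝ E A := by
  obtain ⟨-, -, this⟩ := integral_inner_stdGaussian_eq_trace (h := A) (h' := fun _ => A)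
    (fun x => A.hasFDerivAt) (‖A‖) 1
    (fun x => (A.le_opNorm x).trans (by gcongr; simp))
    (fun x => by have := norm_nonneg x; have := norm_nonneg A; nlinarith)
  simpa using this

lemma integrable_inner_const_stdGaussian (u : E) :
    Integrable (fun x => inner ℝ u x) (stdGaussian E) :=
  (innerSL ℝ u).integrable_comp IsGaussian.integrable_id

lemma integral_norm_sq_stdGaussian :
    ∫ x, ‖x‖ ^ 2 ∂(stdGaussian E) = Module.finrank ℝ E := by
  have := integral_inner_apply_stdGaussian (E := E) (ContinuousLinearMap.id ℝ E)
  simpa using this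

lemma integrable_norm_add_smul_sq (θ : E) (σ : ℝ) :
    Integrable (fun x => ‖θ + σ • x‖ ^ 2) (stdGaussian E) := by
  refine integrable_stdGaussian_of_norm_le (Continuous.aestronglyMeasurable (by fun_prop))
    (2 * ‖θ‖ ^ 2 + 2 * σ ^ 2) 2 fun x => ?_
  rw [Real.norm_of_nonneg (by positivity)]
  have h : ‖θ + σ • x‖ ≤ ‖θ‖ + |σ| * ‖x‖ := (norm_add_le _ _).trans (by rw [norm_smul]; rfl)
  have h2 : ‖θ + σ • x‖ ^ 2 ≤ (‖θ‖ + |σ| * ‖x‖) ^ 2 := by gcongr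
  have h3 : |σ| ^ 2 = σ ^ 2 := sq_abs σ
  nlinarith [sq_nonneg (‖θ‖ - |σ| * ‖x‖), sq_nonneg (‖θ‖ * ‖x‖), sq_nonneg σ]

lemma integral_norm_add_smul_sq (θ : E) (σ : ℝ) :
    ∫ x, ‖θ + σ • x‖ ^ 2 ∂(stdGaussian E) = ‖θ‖ ^ 2 + σ ^ 2 * Module.finrank ℝ E := by
  have e : ∀ x : E, ‖θ + σ • x‖ ^ 2 = ‖θ‖ ^ 2 + 2 * σ * inner ℝ θ x + σ ^ 2 * ‖x‖ ^ 2 := by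
    intro x
    rw [norm_add_sq_real, inner_smul_right, norm_smul, mul_pow, Real.norm_eq_abs, sq_abs]
    ring
  simp_rw [e]
  have i1 : Integrable (fun x : E => 2 * σ * inner ℝ θ x) (stdGaussian E) :=
    (integrable_inner_const_stdGaussian θ).const_mul _
  have i2 : Integrable (fun x : E => σ ^ 2 * ‖x‖ ^ 2) (stdGaussian E) :=
    (integrable_norm_pow_stdGaussian 2).const_mul _
  have i3 : Integrable (fun x : E => ‖θ‖ ^ 2 + 2 * σ * inner ℝ θ x) (stdGaussian E) :=
    (integrable_const _).add i1
  rw [integral_add i3 i2, integral_add (integrable_const _) i1,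
    integral_const_mul, integral_const_mul, integral_inner_const_stdGaussian,
    integral_norm_sq_stdGaussian]
  simp

/-- The distance of a Gaussian vector to a subspace, in mean square. -/
lemma integral_norm_sub_starProjection_sq (T : Submodule ℝ E) (θ : E) (σ : ℝ) :
    Integrable (fun x => ‖(θ + σ • x) - T.starProjection (θ + σ • x)‖ ^ 2) (stdGaussian E) ∧
    ∫ x, ‖(θ + σ • x) - T.starProjection (θ + σ • x)‖ ^ 2 ∂(stdGaussian E)
      = ‖θ - T.starProjection θ‖ ^ 2
        + ((Module.finrank ℝ E : ℝ) - Module.finrank ℝ T) * σ ^ 2 := by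
  set η := θ - T.starProjection θ with hη
  have hP : ∀ x y, inner ℝ (T.starProjection x) y = inner ℝ x (T.starProjection y) := fun x y =>
    Submodule.inner_starProjection_left_eq_right T x y
  have hPP : ∀ x, T.starProjection (T.starProjection x) = T.starProjection x := fun x =>
    Submodule.starProjection_eq_self_iff.2 (Submodule.starProjection_apply_mem T x)
  have e : ∀ x : E, ‖(θ + σ • x) - T.starProjection (θ + σ • x)‖ ^ 2
      = ‖η‖ ^ 2 + 2 * σ * inner ℝ η x
        + σ ^ 2 * (‖x‖ ^ 2 - inner ℝ x (T.starProjection x)) := by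
    intro x
    have e1 : (θ + σ • x) - T.starProjection (θ + σ • x)
        = η + σ • (x - T.starProjection x) := by
      rw [map_add, map_smul, hη, smul_sub]; abel
    have e2 : ‖x - T.starProjection x‖ ^ 2 = ‖x‖ ^ 2 - inner ℝ x (T.starProjection x) := by
      rw [norm_sub_sq_real, ← real_inner_self_eq_norm_sq (T.starProjection x), hP, hPP]
      ring
    have e3 : inner ℝ η (x - T.starProjection x) = inner ℝ η x := by
      rw [inner_sub_right, ← hP, hη, map_sub, hPP]; simp
    rw [e1, norm_add_sq_real, inner_smul_right, norm_smul, mul_pow, Real.norm_eq_abs, sq_abs, e2,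
      e3]
    ring
  have i1 : Integrable (fun x : E => 2 * σ * inner ℝ η x) (stdGaussian E) :=
    (integrable_inner_const_stdGaussian η).const_mul _
  have i2 : Integrable (fun x : E => inner ℝ x (T.starProjection x)) (stdGaussian E) := by
    refine (integrable_norm_pow_stdGaussian 2).mono' (Continuous.aestronglyMeasurable
      (by fun_prop)) (Filter.Eventually.of_forall fun x => ?_)
    refine (norm_inner_le_norm _ _).trans ?_
    rw [sq]
    gcongr
    exact Submodule.norm_starProjection_apply_le T x
  have i3 : Integrable (fun x : E => ‖x‖ ^ 2 - inner ℝ x (T.starProjection x))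
    (stdGaussian E) := (integrable_norm_pow_stdGaussian 2).sub i2
  have i4 : Integrable (fun x : E => ‖η‖ ^ 2 + 2 * σ * inner ℝ η x) (stdGaussian E) :=
    (integrable_const _).add i1
  simp_rw [e]
  refine ⟨i4.add (i3.const_mul _), ?_⟩
  rw [integral_add i4 (i3.const_mul _), integral_add (integrable_const _) i1,
    integral_const_mul, integral_const_mul, integral_inner_const_stdGaussian,
    integral_sub (integrable_norm_pow_stdGaussian 2) i2,
    integral_norm_sq_stdGaussian, integral_inner_apply_stdGaussian, trace_starProjection]
  simp
  ring

/-- The Laplace transform of a noncentral chi-square variable is at most the central one. -/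
lemma integral_exp_neg_norm_add_sq_le (ν : E) {l : ℝ} (hl : 0 ≤ l) :
    Integrable (fun x => Real.exp (-l * ‖ν + x‖ ^ 2)) (stdGaussian E) ∧
    ∫ x, Real.exp (-l * ‖ν + x‖ ^ 2) ∂(stdGaussian E)
      ≤ (1 + 2 * l) ^ (-(Module.finrank ℝ E / 2 : ℝ)) := by
  have hl' : 0 < 1 + 2 * l := by positivity
  constructor
  · refine integrable_stdGaussian_of_norm_le (Continuous.aestronglyMeasurable (by fun_prop)) 1 0
      fun x => ?_
    rw [Real.norm_of_nonneg (by positivity)]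
    have : Real.exp (-l * ‖ν + x‖ ^ 2) ≤ 1 := by
      rw [Real.exp_le_one_iff]
      have := mul_nonneg hl (sq_nonneg ‖ν + x‖)
      linarith
    linarith [pow_zero ‖x‖]
  rw [integral_stdGaussian_eq]
  -- Completing the square: translation invariance then removes the shift, and the remaining factor
  -- involving `ν` is at most one.
  have e : ∀ x : E, gaussianDensity E x • Real.exp (-l * ‖ν + x‖ ^ 2)
      = ((2 * Real.pi) ^ (-(Module.finrank ℝ E / 2 : ℝ))
          * Real.exp (-(l / (1 + 2 * l)) * ‖ν‖ ^ 2))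
        * Real.exp (-(1 / 2 + l) * ‖x + (2 * l / (1 + 2 * l)) • ν‖ ^ 2) := by
    intro x
    rw [gaussianDensity, smul_eq_mul, mul_assoc, mul_assoc, ← Real.exp_add, ← Real.exp_add]
    congr 2
    rw [norm_add_sq_real, norm_add_sq_real, inner_smul_right, norm_smul, mul_pow,
      Real.norm_eq_abs, sq_abs, real_inner_comm]
    field_simp
    ring
  simp_rw [e]
  rw [integral_const_mul,
    integral_add_right_eq_self (μ := (volume : Measure E))
      (fun x => Real.exp (-(1 / 2 + l) * ‖x‖ ^ 2)),
    GaussianFourier.integral_rexp_neg_mul_sq_norm (by positivity)]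
  have e2 : Real.pi / (1 / 2 + l) = (2 * Real.pi) * (1 + 2 * l)⁻¹ := by field_simp
  rw [e2, Real.mul_rpow (x := 2 * Real.pi) (y := (1 + 2 * l)⁻¹) (by positivity) (by positivity),
    Real.rpow_neg hl'.le,
    ← Real.inv_rpow hl'.le]
  have e3 : (2 * Real.pi) ^ (-(Module.finrank ℝ E / 2 : ℝ))
      * (2 * Real.pi) ^ (Module.finrank ℝ E / 2 : ℝ) = 1 := by
    rw [← Real.rpow_add (by positivity)]; simp
  have e4 : Real.exp (-(l / (1 + 2 * l)) * ‖ν‖ ^ 2) ≤ 1 := by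
    rw [Real.exp_le_one_iff]
    have : 0 ≤ l / (1 + 2 * l) * ‖ν‖ ^ 2 := by positivity
    linarith
  have e5 : 0 ≤ ((1 + 2 * l)⁻¹) ^ (Module.finrank ℝ E / 2 : ℝ) := by positivity
  calc _ = ((2 * Real.pi) ^ (-(Module.finrank ℝ E / 2 : ℝ))
      * (2 * Real.pi) ^ (Module.finrank ℝ E / 2 : ℝ))
      * (Real.exp (-(l / (1 + 2 * l)) * ‖ν‖ ^ 2)
      * ((1 + 2 * l)⁻¹) ^ (Module.finrank ℝ E / 2 : ℝ)) := by ring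
    _ ≤ _ := by rw [e3, one_mul]; exact mul_le_of_le_one_left e5 e4

/-- The standard Gaussian measure is the product of those of a subspace and of its orthogonal. -/
lemma stdGaussian_eq_map_prod (K : Submodule ℝ E) :
    stdGaussian E = ((stdGaussian K).prod (stdGaussian Kᗮ)).map
      (fun p => (p.1 : E) + (p.2 : E)) := by
  have hm : Measurable (fun p : K × Kᗮ => (p.1 : E) + (p.2 : E)) := by fun_prop
  have : IsProbabilityMeasure (((stdGaussian K).prod (stdGaussian Kᗮ)).map
      (fun p => (p.1 : E) + (p.2 : E))) := Measure.isProbabilityMeasure_map hm.aemeasurable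
  apply Measure.ext_of_charFun
  ext t
  rw [charFun_stdGaussian, charFun_apply, integral_map hm.aemeasurable (by fun_prop)]
  have e : ∀ p : K × Kᗮ, Complex.exp (inner ℝ ((p.1 : E) + (p.2 : E)) t * Complex.I)
      = Complex.exp (inner ℝ p.1 (K.orthogonalProjectionOnto t) * Complex.I)
        * Complex.exp (inner ℝ p.2 (Kᗮ.orthogonalProjectionOnto t) * Complex.I) := by
    intro p
    rw [← Complex.exp_add, inner_add_left,
      Submodule.inner_orthogonalProjectionOnto_eq_of_mem_left,
      Submodule.inner_orthogonalProjectionOnto_eq_of_mem_left]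
    push_cast
    ring_nf
  simp_rw [e]
  rw [integral_prod_mul (μ := stdGaussian K) (ν := stdGaussian Kᗮ)
    (fun x => Complex.exp (inner ℝ x (K.orthogonalProjectionOnto t) * Complex.I))
    (fun y => Complex.exp (inner ℝ y (Kᗮ.orthogonalProjectionOnto t) * Complex.I)),
    ← charFun_apply, ← charFun_apply, charFun_stdGaussian, charFun_stdGaussian, ← Complex.exp_add]
  have h := congrArg (fun r : ℝ => (r : ℂ)) (Submodule.norm_sq_eq_add_norm_sq_projection t K)
  push_cast at h
  rw [h]
  ring_nf

end StdGaussian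

/-! ### Lower tails and truncated inverse moments of noncentral chi-square variables. -/

section ChiSquare

lemma phi_pos {x : ℝ} (h0 : 0 < x) (h1 : x < 1) : 0 < phi x := by
  have := Real.log_lt_sub_one_of_pos h0 h1.ne
  unfold phi; linarith

lemma exp_le_cubic {y : ℝ} (h0 : 0 ≤ y) (h1 : y ≤ 1) :
    Real.exp y ≤ 1 + y + y ^ 2 / 2 + 2 / 9 * y ^ 3 := by
  have := Real.exp_bound' h0 h1 (n := 3) (by norm_num)
  norm_num [Finset.sum_range_succ, Nat.factorial] at this
  linarith

/-- This is z ≤ sinh z at z = -log a, multiplied by a. It is sharp to second order at a = 1. -/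
lemma mul_neg_log_le_sq {a : ℝ} (h0 : 0 < a) (h1 : a ≤ 1) :
    a * (a - 1 - Real.log a) ≤ (1 - a) ^ 2 / 2 := by
  have h := Real.self_le_sinh_iff.2 (neg_nonneg.2 (Real.log_nonpos h0.le h1))
  rw [Real.sinh_eq, neg_neg, Real.exp_neg, Real.exp_log h0] at h
  have h2 := mul_le_mul_of_nonneg_left h h0.le
  have h3 : a * ((a⁻¹ - a) / 2) = (1 - a ^ 2) / 2 := by field_simp
  rw [h3] at h2
  nlinarith

/-- The concave function -a log a lies below its tangent at c. -/
lemma mul_neg_log_le_tangent {a c : ℝ} (h0 : 0 < a) (hc : 0 < c) :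
    a * (a - 1 - Real.log a) ≤ a ^ 2 - a * (2 + Real.log c) + c := by
  have h := Real.log_le_sub_one_of_pos (div_pos hc h0)
  rw [Real.log_div hc.ne' h0.ne'] at h
  have h2 := mul_le_mul_of_nonneg_left h h0.le
  have h3 : a * (c / a - 1) = c - a := by field_simp
  rw [h3] at h2
  nlinarith

/-- This numerical inequality turns the constant of the truncated inverse moment into exactly the
one in `epsilonN`. The exponential is replaced by a cubic. Then a log a is bounded by tangents at
1/8, 1/4 and 1/2 for small a, where only decimal bounds on log 2 are needed, and by the sinh bound
from 0.45 on. -/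
lemma four_mul_exp_mul_phi_le {a : ℝ} (h0 : 0 < a) (h1 : a < 1) :
    4 * a * Real.exp (1 - a) * phi a ≤ 1 - a := by
  have hE := exp_le_cubic (y := 1 - a) (by linarith) (by linarith)
  set T := 1 + (1 - a) + (1 - a) ^ 2 / 2 + 2 / 9 * (1 - a) ^ 3 with hT
  have key : 2 * T * (a * (a - 1 - Real.log a)) ≤ 1 - a := by
    have hTpos : 0 < T := (Real.exp_pos _).trans_le hE
    have hl2 := Real.log_two_lt_d9
    have hl2' := Real.log_two_gt_d9
    have tan : ∀ k : ℕ, a * (a - 1 - Real.log a)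
        ≤ a ^ 2 - a * (2 - k * Real.log 2) + (1 / 2) ^ k := by
      intro k
      have := mul_neg_log_le_tangent h0 (c := (1 / 2) ^ k) (by positivity)
      rw [Real.log_pow, one_div, Real.log_inv] at this
      rw [one_div]
      linarith
    rcases le_total a 0.17 with h | h
    · have h3 : a * (a - 1 - Real.log a) ≤ a ^ 2 + 0.08 * a + 0.125 := by
        have := tan 3; norm_num at this; nlinarith
      refine (mul_le_mul_of_nonneg_left h3 (by positivity)).trans ?_
      rw [hT]
      nlinarith [mul_nonneg h0.le (sub_nonneg.2 h), pow_pos h0 3, pow_pos h0 2, pow_pos h0 4,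
        pow_pos h0 5]
    rcases le_total a 0.36 with h' | h'
    · have h3 : a * (a - 1 - Real.log a) ≤ a ^ 2 - 0.6137 * a + 0.25 := by
        have := tan 2; norm_num at this; nlinarith
      refine (mul_le_mul_of_nonneg_left h3 (by positivity)).trans ?_
      rw [hT]
      nlinarith [mul_nonneg (sub_nonneg.2 h) (sub_nonneg.2 h'), pow_pos h0 3, pow_pos h0 2,
        mul_nonneg (mul_nonneg (sub_nonneg.2 h) (sub_nonneg.2 h')) h0.le,
        mul_nonneg (mul_nonneg (sub_nonneg.2 h) (sub_nonneg.2 h')) (pow_pos h0 2).le,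
        mul_nonneg (mul_nonneg (sub_nonneg.2 h) (sub_nonneg.2 h')) (pow_pos h0 3).le]
    rcases le_total a 0.45 with h'' | h''
    · have h3 : a * (a - 1 - Real.log a) ≤ a ^ 2 - 1.3068 * a + 0.5 := by
        have := tan 1; norm_num at this; nlinarith
      refine (mul_le_mul_of_nonneg_left h3 (by positivity)).trans ?_
      rw [hT]
      nlinarith [mul_nonneg (sub_nonneg.2 h') (sub_nonneg.2 h''), pow_pos h0 3, pow_pos h0 2,
        mul_nonneg (mul_nonneg (sub_nonneg.2 h') (sub_nonneg.2 h'')) h0.le,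
        mul_nonneg (mul_nonneg (sub_nonneg.2 h') (sub_nonneg.2 h'')) (pow_pos h0 2).le,
        mul_nonneg (mul_nonneg (sub_nonneg.2 h') (sub_nonneg.2 h'')) (pow_pos h0 3).le]
    · have h3 := mul_neg_log_le_sq h0 h1.le
      have h4 : T * (1 - a) ≤ 1 := by
        have hy : 1 - a ≤ 0.55 := by linarith
        have hy0 : 0 ≤ 1 - a := by linarith
        have hT' : T ≤ 1 + 0.55 + 0.55 ^ 2 / 2 + 2 / 9 * 0.55 ^ 3 := by rw [hT]; gcongr
        calc T * (1 - a) ≤ (1 + 0.55 + 0.55 ^ 2 / 2 + 2 / 9 * 0.55 ^ 3) * 0.55 := by gcongr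
          _ ≤ 1 := by norm_num
      calc 2 * T * (a * (a - 1 - Real.log a)) ≤ 2 * T * ((1 - a) ^ 2 / 2) := by gcongr
        _ = (T * (1 - a)) * (1 - a) := by ring
        _ ≤ 1 * (1 - a) := by
          apply mul_le_mul_of_nonneg_right h4; linarith
        _ = 1 - a := one_mul _
  have hphi := phi_pos h0 h1
  calc 4 * a * Real.exp (1 - a) * phi a ≤ 4 * a * T * phi a := by gcongr
    _ = 2 * T * (a * (a - 1 - Real.log a)) := by unfold phi; ring
    _ ≤ 1 - a := key

/-- The function exp(y)/y decreases on (0, 1], because log(y/x) ≥ 1 - x/y ≥ y - x there. -/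
lemma exp_div_self_antitone {x y : ℝ} (hx : 0 < x) (hxy : x ≤ y) (hy : y ≤ 1) :
    x * Real.exp y ≤ y * Real.exp x := by
  have hy0 : 0 < y := hx.trans_le hxy
  have h := Real.one_sub_inv_le_log_of_pos (div_pos hy0 hx)
  rw [inv_div] at h
  have h2 : y - x ≤ 1 - x / y := by
    have : 1 - x / y = (y - x) / y := by field_simp
    rw [this, le_div_iff₀ hy0]
    nlinarith
  have h3 : Real.exp (y - x) ≤ y / x := by
    rw [← Real.le_log_iff_exp_le (by positivity)]; linarith
  rw [Real.exp_sub, div_le_div_iff₀ (Real.exp_pos _) hx] at h3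
  linarith

variable {E : Type*} [NormedAddCommGroup E] [InnerProductSpace ℝ E] [FiniteDimensional ℝ E]
  [MeasurableSpace E] [BorelSpace E]

/-- Chernoff's lower tail bound for noncentral chi-square variables. -/
lemma stdGaussian_real_norm_add_sq_le (ν : E) {x : ℝ} (h0 : 0 < x) (h1 : x < 1) :
    (stdGaussian E).real {u | ‖ν + u‖ ^ 2 ≤ x * Module.finrank ℝ E}
      ≤ Real.exp (-(Module.finrank ℝ E) * phi x) := by
  set N : ℝ := (Module.finrank ℝ E : ℝ)
  -- The optimal Chernoff parameter for the central chi-square law, characterized by 1 + 2l = 1/x.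
  set l : ℝ := (x⁻¹ - 1) / 2 with hl
  have hl0 : 0 ≤ l := by
    have := (one_lt_inv₀ h0).2 h1
    rw [hl]; linarith
  obtain ⟨hi, hle⟩ := integral_exp_neg_norm_add_sq_le ν hl0
  have h := measure_le_le_exp_mul_mgf (μ := stdGaussian E) (X := fun u => ‖ν + u‖ ^ 2) (t := -l)
    (x * N) (by linarith) hi
  refine h.trans ?_
  rw [mgf]
  refine (mul_le_mul_of_nonneg_left hle (Real.exp_nonneg _)).trans_eq ?_
  have e1 : 1 + 2 * l = x⁻¹ := by rw [hl]; ring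
  rw [e1, Real.inv_rpow h0.le, Real.rpow_neg h0.le, inv_inv, Real.rpow_def_of_pos h0,
    ← Real.exp_add]
  congr 1
  rw [hl, phi]
  field_simp
  ring

/-- With k = N - 2, this exact derivative dominates the Chernoff tail up to a constant, so the tail
integral can be evaluated in closed form. -/
lemma hasDerivAt_exp_phi_div {a k t : ℝ} (ha : 0 < a) (ht : 0 ≤ t) :
    HasDerivAt (fun t => Real.exp (-k * phi (a / (1 + t))))
      (-(k * (1 - a / (1 + t)) / (2 * (1 + t))) * Real.exp (-k * phi (a / (1 + t)))) t := by
  have ht' : 0 < 1 + t := by linarith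
  have hx : HasDerivAt (fun t => a / (1 + t)) (-(a / (1 + t) ^ 2)) t := by
    have := ((hasDerivAt_id t).const_add 1).fun_inv ht'.ne' |>.const_mul a
    refine (this.congr_deriv ?_).congr_of_eventuallyEq ?_
    · simp; ring
    · exact Filter.Eventually.of_forall fun t => by simp [div_eq_mul_inv]
  have hphi : HasDerivAt (fun t => phi (a / (1 + t))) ((1 - a / (1 + t)) / (2 * (1 + t))) t := by
    unfold phi
    refine (((hx.sub_const 1).sub (hx.log (by positivity))).div_const 2).congr_deriv ?_
    field_simp
    ring
  refine (hphi.const_mul (-k)).exp.congr_deriv ?_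
  ring

lemma tendsto_exp_phi_div {a k : ℝ} (ha : 0 < a) (hk : 0 < k) :
    Filter.Tendsto (fun t => Real.exp (-k * phi (a / (1 + t)))) Filter.atTop (nhds 0) := by
  refine Real.tendsto_exp_atBot.comp ?_
  have h1 : Filter.Tendsto (fun t : ℝ => a / (1 + t)) Filter.atTop (nhdsWithin 0 (Set.Ioi 0)) := by
    refine tendsto_nhdsWithin_iff.2 ⟨?_, ?_⟩
    · exact tendsto_const_nhds.div_atTop (Filter.tendsto_atTop_add_const_left _ 1 Filter.tendsto_id)
    · filter_upwards [Filter.eventually_ge_atTop (0 : ℝ)] with t ht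
      exact div_pos ha (by linarith)
  have h2 : Filter.Tendsto phi (nhdsWithin 0 (Set.Ioi 0)) Filter.atTop := by
    unfold phi
    refine Filter.Tendsto.atTop_div_const (by norm_num) ?_
    simp_rw [sub_eq_add_neg]
    refine Filter.Tendsto.add_atTop (C := 0 + -1) ?_ ?_
    · exact (Filter.tendsto_id.mono_left nhdsWithin_le_nhds).add_const _
    · exact Filter.tendsto_neg_atBot_atTop.comp Real.tendsto_log_nhdsGT_zero
  exact Filter.Tendsto.const_mul_atTop_of_neg (by linarith) (h2.comp h1)

/-- A bound on the positive part of an inverse noncentral chi-square variable. -/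
lemma integral_inv_norm_add_sq_posPart_le (ν : E) {a : ℝ} (h0 : 0 < a) (h1 : a < 1)
    (hN : (2 : ℝ) < Module.finrank ℝ E) :
    Integrable (fun u => max (a * Module.finrank ℝ E / ‖ν + u‖ ^ 2 - 1) 0) (stdGaussian E) ∧
    ∫ u, max (a * Module.finrank ℝ E / ‖ν + u‖ ^ 2 - 1) 0 ∂(stdGaussian E)
      ≤ 2 * a * Real.exp (1 - a) / (((Module.finrank ℝ E : ℝ) - 2) * (1 - a))
        * Real.exp (-((Module.finrank ℝ E : ℝ) - 2) * phi a) := by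
  set N : ℝ := (Module.finrank ℝ E : ℝ) with hNdef
  set f : E → ℝ := fun u => max (a * N / ‖ν + u‖ ^ 2 - 1) 0 with hf
  set K : ℝ := 2 * a * Real.exp (1 - a) / ((N - 2) * (1 - a)) with hK
  set F' : ℝ → ℝ := fun t =>
    -((N - 2) * (1 - a / (1 + t)) / (2 * (1 + t))) * Real.exp (-(N - 2) * phi (a / (1 + t)))
    with hF'
  have hN2 : 0 < N - 2 := by linarith
  have h1a : 0 < 1 - a := by linarith
  have hf0 : ∀ u, 0 ≤ f u := fun u => le_max_right _ _
  have hfm : Measurable f := by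
    rw [hf]; fun_prop
  have hx : ∀ t : ℝ, 0 < t → 0 < a / (1 + t) ∧ a / (1 + t) < a := by
    intro t ht
    exact ⟨by positivity, div_lt_self h0 (by linarith)⟩
  have hderiv : ∀ t ∈ Set.Ici (0 : ℝ), HasDerivAt
      (fun t => Real.exp (-(N - 2) * phi (a / (1 + t)))) (F' t) t := fun t ht =>
    hasDerivAt_exp_phi_div h0 ht
  have hF'neg : ∀ t ∈ Set.Ioi (0 : ℝ), F' t ≤ 0 := by
    intro t ht
    have ht' : 0 < t := ht
    have := hx t ht
    have h2 : 0 ≤ 1 - a / (1 + t) := by linarith [this.2]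
    rw [hF']
    simp only [neg_mul, Left.neg_nonpos_iff]
    positivity
  have hint := integrableOn_Ioi_deriv_of_nonpos' hderiv hF'neg (tendsto_exp_phi_div h0 hN2)
  have hval := integral_Ioi_of_hasDerivAt_of_nonpos' hderiv hF'neg (tendsto_exp_phi_div h0 hN2)
  -- Two degrees of freedom are set aside: exp(-2φ(x)) = x exp(1 - x). Since 1 + t = a/x, its factor
  -- x matches the 1/(1 + t) in the derivative, and the rest is monotonicity of exp(y)/y between 1 -
  -- a and 1 - x.
  have hbound : ∀ t ∈ Set.Ioi (0 : ℝ), Real.exp (-N * phi (a / (1 + t))) ≤ -(K * F' t) := by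
    intro t ht
    have ht' : (0 : ℝ) < t := ht
    obtain ⟨hx0, hxa⟩ := hx t ht
    set x := a / (1 + t) with hxdef
    have hxt : 1 + t = a / x := by rw [hxdef]; field_simp
    have e1 : Real.exp (-N * phi x) = Real.exp (-(N - 2) * phi x) * (x * Real.exp (1 - x)) := by
      have e0 : x * Real.exp (1 - x) = Real.exp (Real.log x + (1 - x)) := by
        rw [Real.exp_add, Real.exp_log hx0]
      rw [e0, ← Real.exp_add]
      congr 1
      unfold phi
      ring
    have e2 : -(K * F' t) = Real.exp (-(N - 2) * phi x)
        * (x * (Real.exp (1 - a) * (1 - x) / (1 - a))) := by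
      simp only [hF', ← hxdef]
      rw [hK, hxt]
      field_simp
    rw [e1, e2]
    gcongr
    rw [le_div_iff₀ h1a]
    have := exp_div_self_antitone h1a (show 1 - a ≤ 1 - x by linarith) (by linarith)
    linarith
  have hlint : ∫⁻ u, ENNReal.ofReal (f u) ∂(stdGaussian E)
      ≤ ENNReal.ofReal (K * Real.exp (-(N - 2) * phi a)) := by
    -- Layer cake: for t > 0 the event t < f is a lower deviation of the squared norm at level a/(1
    -- + t).
    rw [lintegral_eq_lintegral_meas_lt _ (Filter.Eventually.of_forall hf0) hfm.aemeasurable]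
    calc ∫⁻ t in Set.Ioi 0, (stdGaussian E) {u | t < f u}
        ≤ ∫⁻ t in Set.Ioi 0, ENNReal.ofReal (-(K * F' t)) := by
          refine setLIntegral_mono' measurableSet_Ioi fun t ht => ?_
          obtain ⟨hx0, hxa⟩ := hx t ht
          have ht' : (0 : ℝ) < t := ht
          have hsub : {u | t < f u} ⊆ {u | ‖ν + u‖ ^ 2 ≤ a / (1 + t) * N} := by
            intro u hu
            have hu' : t < a * N / ‖ν + u‖ ^ 2 - 1 := by
              rcases lt_max_iff.1 (show t < max _ _ from hu) with h | h
              · exact h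
              · exact absurd h (not_lt.2 ht'.le)
            have hpos : 0 < ‖ν + u‖ ^ 2 := by
              rcases (sq_nonneg ‖ν + u‖).eq_or_lt with h | h
              · rw [← h, div_zero] at hu'; linarith
              · exact h
            have h3 : 1 + t < a * N / ‖ν + u‖ ^ 2 := by linarith
            rw [lt_div_iff₀ hpos] at h3
            change ‖ν + u‖ ^ 2 ≤ a / (1 + t) * N
            rw [div_mul_eq_mul_div, le_div_iff₀ (by positivity)]
            linarith
          refine (measure_mono hsub).trans ?_
          rw [← ofReal_measureReal]
          exact ENNReal.ofReal_le_ofReal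
            ((stdGaussian_real_norm_add_sq_le ν hx0 (hxa.trans h1)).trans (hbound t ht))
      _ = ENNReal.ofReal (∫ t in Set.Ioi 0, -(K * F' t)) := by
          have hint' : IntegrableOn (fun t => -(K * F' t)) (Set.Ioi 0) := (hint.const_mul K).neg
          rw [ofReal_integral_eq_lintegral_ofReal hint']
          refine (ae_restrict_iff' measurableSet_Ioi).2 (Filter.Eventually.of_forall fun t ht => ?_)
          exact (Real.exp_nonneg _).trans (hbound t ht)
      _ = _ := by
          rw [integral_neg, integral_const_mul, hval]
          simp
  have hpos : 0 ≤ K * Real.exp (-(N - 2) * phi a) := by positivity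
  have hfi : Integrable f (stdGaussian E) := by
    refine ⟨hfm.aestronglyMeasurable, ?_⟩
    rw [hasFiniteIntegral_iff_ofReal (Filter.Eventually.of_forall hf0)]
    exact hlint.trans_lt ENNReal.ofReal_lt_top
  refine ⟨hfi, ?_⟩
  rw [← ENNReal.ofReal_le_ofReal_iff hpos,
    ofReal_integral_eq_lintegral_ofReal hfi (Filter.Eventually.of_forall hf0)]
  exact hlint

/-- Under the lower bound on the residual dimension, the variance estimator is rarely small. -/
lemma integral_inv_norm_add_sq_posPart_le_epsilonN (ν : E) {a : ℝ} (h0 : 0 < a) (h1 : a < 1)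
    {n : ℕ} (hn : 3 ≤ n) (hN : 2 + Real.log n / phi a ≤ Module.finrank ℝ E) :
    Integrable (fun u => max (a * Module.finrank ℝ E / ‖ν + u‖ ^ 2 - 1) 0) (stdGaussian E) ∧
    ∫ u, max (a * Module.finrank ℝ E / ‖ν + u‖ ^ 2 - 1) 0 ∂(stdGaussian E) ≤ epsilonN n := by
  have hphi := phi_pos h0 h1
  have hn' : (3 : ℝ) ≤ n := by exact_mod_cast hn
  have hlog : 0 < Real.log n := Real.log_pos (by linarith)
  have hN2 : (2 : ℝ) < Module.finrank ℝ E := by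
    have : 0 < Real.log n / phi a := by positivity
    linarith
  obtain ⟨hi, hle⟩ := integral_inv_norm_add_sq_posPart_le ν h0 h1 hN2
  refine ⟨hi, hle.trans ?_⟩
  set k : ℝ := (Module.finrank ℝ E : ℝ) - 2 with hk
  have hk0 : 0 < k := by linarith
  have h1a : 0 < 1 - a := by linarith
  have hz : Real.log n ≤ k * phi a := by
    rw [← div_le_iff₀ hphi]; linarith
  have hexp : (n : ℝ) ≤ Real.exp (k * phi a) := by
    rw [← Real.log_le_iff_le_exp (by linarith)]; exact hz
  have e1 : 2 * a * Real.exp (1 - a) / (k * (1 - a)) ≤ 1 / (2 * (k * phi a)) := by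
    rw [div_le_div_iff₀ (by positivity) (by positivity)]
    have := mul_le_mul_of_nonneg_left (four_mul_exp_mul_phi_le h0 h1) hk0.le
    linarith
  -- With z = kφ(a) the bound is exp(-z)/(2z), decreasing in z, and the dimension hypothesis says z
  -- ≥ log n.
  calc _ ≤ 1 / (2 * (k * phi a)) * Real.exp (-k * phi a) := by gcongr
    _ = 1 / (2 * Real.exp (k * phi a) * (k * phi a)) := by
      rw [neg_mul, Real.exp_neg]; field_simp
    _ ≤ 1 / (2 * n * Real.log n) := by gcongr
    _ = epsilonN n := by rw [epsilonN, one_div]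

end ChiSquare

/-! ### Gibbs distributions and the free energy. -/

section Gibbs

variable {M : Type*} [Fintype M]

/-- The partition function of the prior `π` with energy `q`. -/
noncomputable def partition (π q : M → ℝ) : ℝ := ∑ m, π m * Real.exp (-q m)

/-- The Gibbs distribution with prior `π` and energy `q`. -/
noncomputable def gibbs (π q : M → ℝ) (m : M) : ℝ := π m * Real.exp (-q m) / partition π q

variable {π : M → ℝ}

lemma partition_pos (hπ : ∀ m, 0 ≤ π m) (hsum : ∑ m, π m = 1)
    (q : M → ℝ) : 0 < partition π q := by
  have hne : ∃ m, 0 < π m := by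
    by_contra! h
    have : ∑ m, π m ≤ 0 := Finset.sum_nonpos fun m _ => h m
    linarith
  obtain ⟨m, hm⟩ := hne
  exact Finset.sum_pos' (fun k _ => mul_nonneg (hπ k) (Real.exp_nonneg _))
    ⟨m, Finset.mem_univ m, mul_pos hm (Real.exp_pos _)⟩

lemma gibbs_nonneg (hπ : ∀ m, 0 ≤ π m) (hsum : ∑ m, π m = 1)
    (q : M → ℝ) (m : M) : 0 ≤ gibbs π q m :=
  div_nonneg (mul_nonneg (hπ m) (Real.exp_nonneg _)) (partition_pos hπ hsum q).le

lemma sum_gibbs (hπ : ∀ m, 0 ≤ π m) (hsum : ∑ m, π m = 1)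
    (q : M → ℝ) : ∑ m, gibbs π q m = 1 := by
  simp_rw [gibbs]
  rw [← Finset.sum_div]
  exact div_self (partition_pos hπ hsum q).ne'

/-- The free energy is concave: it lies below its tangent hyperplanes. -/
lemma neg_log_partition_le (hπ : ∀ m, 0 ≤ π m) (hsum : ∑ m, π m = 1)
    (q r : M → ℝ) :
    -Real.log (partition π q)
      ≤ -Real.log (partition π r) + ∑ m, gibbs π r m * (q m - r m) := by
  -- Jensen for exp under the Gibbs weights of `r`: the mean of exp(r - q) is the ratio of the
  -- partition functions.
  have hJ := convexOn_exp.map_sum_le (t := Finset.univ) (w := gibbs π r)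
    (p := fun m => r m - q m) (fun m _ => gibbs_nonneg hπ hsum r m) (sum_gibbs hπ hsum r)
    (fun m _ => Set.mem_univ _)
  simp only [smul_eq_mul] at hJ
  have h1 : ∑ m, gibbs π r m * Real.exp (r m - q m) = partition π q / partition π r := by
    rw [partition, Finset.sum_div]
    refine Finset.sum_congr rfl fun m _ => ?_
    rw [gibbs, div_mul_eq_mul_div, mul_assoc, ← Real.exp_add]
    congr 3
    ring
  rw [h1, ← Real.le_log_iff_exp_le (div_pos (partition_pos hπ hsum q) (partition_pos hπ hsum r)),
    Real.log_div (partition_pos hπ hsum q).ne' (partition_pos hπ hsum r).ne'] at hJ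
  have h2 : ∑ m, gibbs π r m * (q m - r m) = -∑ m, gibbs π r m * (r m - q m) := by
    rw [← Finset.sum_neg_distrib]
    exact Finset.sum_congr rfl fun m _ => by ring
  rw [h2]
  linarith

/-- The tangent at `q`, evaluated at zero energy where the partition function is one. The gap is the
relative entropy of the Gibbs distribution with respect to the prior. -/
lemma sum_gibbs_mul_le (hπ : ∀ m, 0 ≤ π m) (hsum : ∑ m, π m = 1)
    (q : M → ℝ) : ∑ m, gibbs π q m * q m ≤ -Real.log (partition π q) := by
  have h := neg_log_partition_le hπ hsum (fun _ => 0) q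
  have h0 : partition π (fun _ => 0) = 1 := by simp [partition, hsum]
  rw [h0, Real.log_one] at h
  simp only [zero_sub, mul_neg, Finset.sum_neg_distrib] at h
  linarith

lemma partition_add_const (q : M → ℝ) (c : ℝ) :
    partition π (fun m => q m + c) = Real.exp (-c) * partition π q := by
  rw [partition, partition, Finset.mul_sum]
  refine Finset.sum_congr rfl fun m _ => ?_
  rw [neg_add, Real.exp_add]
  ring

lemma gibbs_add_const (q : M → ℝ) (c : ℝ) : gibbs π (fun m => q m + c) = gibbs π q := by
  ext m
  rw [gibbs, partition_add_const, gibbs, neg_add, Real.exp_add]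
  have := (Real.exp_pos (-c)).ne'
  rw [mul_comm (Real.exp (-q m)), ← mul_assoc, mul_comm (π m), mul_assoc,
    mul_div_mul_left _ _ this]

end Gibbs

/-! ### Bias-variance identities for weighted means. -/

section WeightedMean

variable {M E : Type*} [Fintype M] [NormedAddCommGroup E] [InnerProductSpace ℝ E]

lemma sum_mul_inner_sub_mean_eq_zero {w : M → ℝ} (hw : ∑ m, w m = 1) (p : M → E) (z : E) :
    ∑ m, w m * inner ℝ (p m - ∑ k, w k • p k) z = 0 := by
  simp_rw [inner_sub_left, mul_sub]
  rw [Finset.sum_sub_distrib, ← Finset.sum_mul, hw, one_mul, sum_inner]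
  simp_rw [inner_smul_left]
  simp

lemma sum_mul_norm_sub_sq {w : M → ℝ} (hw : ∑ m, w m = 1) (p : M → E) (y : E) :
    ∑ m, w m * ‖y - p m‖ ^ 2
      = ∑ m, w m * ‖p m - ∑ k, w k • p k‖ ^ 2 + ‖y - ∑ k, w k • p k‖ ^ 2 := by
  set g := ∑ k, w k • p k with hg
  have e : ∀ m, w m * ‖y - p m‖ ^ 2 = w m * ‖p m - g‖ ^ 2
      - 2 * (w m * inner ℝ (p m - g) (y - g)) + w m * ‖y - g‖ ^ 2 := by
    intro m
    have : y - p m = (y - g) - (p m - g) := by abel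
    rw [this, norm_sub_sq_real, real_inner_comm]
    ring
  simp_rw [e]
  rw [Finset.sum_add_distrib, Finset.sum_sub_distrib, ← Finset.mul_sum, ← Finset.sum_mul, hw,
    sum_mul_inner_sub_mean_eq_zero hw]
  ring

lemma sum_mul_inner_sub_mean {w : M → ℝ} (hw : ∑ m, w m = 1) (p : M → E) :
    ∑ m, w m * inner ℝ (p m - ∑ k, w k • p k) (p m)
      = ∑ m, w m * ‖p m - ∑ k, w k • p k‖ ^ 2 := by
  set g := ∑ k, w k • p k with hg
  have e : ∀ m, w m * inner ℝ (p m - g) (p m)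
      = w m * ‖p m - g‖ ^ 2 + w m * inner ℝ (p m - g) g := by
    intro m
    rw [← real_inner_self_eq_norm_sq, ← mul_add, ← inner_add_right, sub_add_cancel]
  simp_rw [e]
  rw [Finset.sum_add_distrib, sum_mul_inner_sub_mean_eq_zero hw, add_zero]

end WeightedMean

/-! ### Risk at a fixed temperature, through Stein's unbiased risk estimate. -/

section ConditionalRisk

variable {M E : Type*} [Fintype M] [NormedAddCommGroup E] [InnerProductSpace ℝ E]
  [FiniteDimensional ℝ E]

/-- The energy of the models `T` at the observation `y`, with inverse temperature `b`. -/
noncomputable def energy (T : M → Submodule ℝ E) (L : M → ℝ) (b : ℝ) (y : E) (m : M) : ℝ :=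
  L m - b * ‖(T m).starProjection y‖ ^ 2

/-- The Gibbs mixture of the projections of `y` on the models `T`. -/
noncomputable def gibbsMixture (T : M → Submodule ℝ E) (π L : M → ℝ) (b : ℝ) (y : E) : E :=
  ∑ m, gibbs π (energy T L b y) m • (T m).starProjection y

/-- The derivative of `gibbsMixture`. -/
noncomputable def gibbsMixtureDeriv (T : M → Submodule ℝ E) (π L : M → ℝ) (b : ℝ) (y : E) :
    E →L[ℝ] E :=
  ∑ m, (gibbs π (energy T L b y) m • (T m).starProjection
    + (gibbs π (energy T L b y) m • (2 * b) •
      innerSL ℝ ((T m).starProjection y - gibbsMixture T π L b y)).smulRight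
        ((T m).starProjection y))

lemma hasFDerivAt_norm_starProjection_sq (T : Submodule ℝ E) (y : E) :
    HasFDerivAt (fun y => ‖T.starProjection y‖ ^ 2) ((2 : ℝ) • innerSL ℝ (T.starProjection y))
      y := by
  refine (T.starProjection.hasFDerivAt.norm_sq).congr_fderiv ?_
  ext v
  have h : inner ℝ (T.starProjection y) (T.starProjection v) = inner ℝ (T.starProjection y) v := by
    rw [← Submodule.inner_starProjection_left_eq_right, Submodule.starProjection_eq_self_iff.2
      (Submodule.starProjection_apply_mem T y)]
  simp [h]

variable {T : M → Submodule ℝ E} {π L : M → ℝ} {b : ℝ}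

/-- The gradient of a log-weight is 2b times its projection minus the weighted mean; the mean comes
from the normalization. -/
lemma hasFDerivAt_gibbs_energy (hπ : ∀ m, 0 ≤ π m) (hsum : ∑ m, π m = 1)
    (y : E) (m : M) :
    HasFDerivAt (fun y => gibbs π (energy T L b y) m)
      (gibbs π (energy T L b y) m • (2 * b) •
        innerSL ℝ ((T m).starProjection y - gibbsMixture T π L b y)) y := by
  have he : ∀ k, HasFDerivAt (fun y => π k * Real.exp (-energy T L b y k))
      ((π k * Real.exp (-energy T L b y k)) • (2 * b) • innerSL ℝ ((T k).starProjection y)) y := by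
    intro k
    unfold energy
    refine (((((hasFDerivAt_norm_starProjection_sq (T k) y).const_mul b).const_sub (L k)).neg.exp
      ).const_mul (π k)).congr_fderiv ?_
    ext v
    simp
    ring
  have hZ : HasFDerivAt (fun y => partition π (energy T L b y))
      (∑ k, (π k * Real.exp (-energy T L b y k)) • (2 * b) •
        innerSL ℝ ((T k).starProjection y)) y := HasFDerivAt.fun_sum fun k _ => he k
  have hZ0 := (partition_pos hπ hsum (energy T L b y)).ne'
  have hinv := (hasDerivAt_inv hZ0).comp_hasFDerivAt y hZ
  refine (((he m).mul hinv).congr_fderiv ?_).congr_of_eventuallyEq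
    (Filter.Eventually.of_forall fun y => by simp [gibbs, div_eq_mul_inv])
  ext v
  have hG : inner ℝ (gibbsMixture T π L b y) v
      = (∑ k, π k * Real.exp (-energy T L b y k) * inner ℝ ((T k).starProjection y) v)
        / partition π (energy T L b y) := by
    rw [gibbsMixture, sum_inner, Finset.sum_div]
    refine Finset.sum_congr rfl fun k _ => ?_
    rw [inner_smul_left, gibbs]
    simp
    ring
  have hS : ∑ k, π k * Real.exp (-energy T L b y k) * (2 * b *
      inner ℝ ((T k).starProjection y) v) = 2 * b *
      ∑ k, π k * Real.exp (-energy T L b y k) * inner ℝ ((T k).starProjection y) v := by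
    rw [Finset.mul_sum]
    exact Finset.sum_congr rfl fun k _ => by ring
  simp only [add_apply, smul_apply,
    sum_apply, innerSL_apply_apply, smul_eq_mul, inner_sub_left, hG, hS,
    Function.comp_apply]
  rw [gibbs]
  field_simp
  ring

lemma hasFDerivAt_gibbsMixture (hπ : ∀ m, 0 ≤ π m) (hsum : ∑ m, π m = 1)
    (y : E) :
    HasFDerivAt (gibbsMixture T π L b) (gibbsMixtureDeriv T π L b y) y :=
  HasFDerivAt.fun_sum fun m _ =>
    (hasFDerivAt_gibbs_energy hπ hsum y m).smul (T m).starProjection.hasFDerivAt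

lemma norm_gibbsMixture_le (hπ : ∀ m, 0 ≤ π m) (hsum : ∑ m, π m = 1)
    (y : E) : ‖gibbsMixture T π L b y‖ ≤ ‖y‖ := by
  calc ‖gibbsMixture T π L b y‖
      ≤ ∑ m, ‖gibbs π (energy T L b y) m • (T m).starProjection y‖ := norm_sum_le _ _
    _ ≤ ∑ m, gibbs π (energy T L b y) m * ‖y‖ := by
        refine Finset.sum_le_sum fun m _ => ?_
        have := gibbs_nonneg hπ hsum (energy T L b y) m
        rw [norm_smul, Real.norm_of_nonneg this]
        gcongr
        exact Submodule.norm_starProjection_apply_le _ y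
    _ = ‖y‖ := by rw [← Finset.sum_mul, sum_gibbs hπ hsum, one_mul]

lemma norm_gibbsMixtureDeriv_le (hπ : ∀ m, 0 ≤ π m) (hsum : ∑ m, π m = 1)
    (hb : 0 ≤ b) (y : E) :
    ‖gibbsMixtureDeriv T π L b y‖ ≤ 1 + 4 * b * ‖y‖ ^ 2 := by
  have hterm : ∀ m, ‖gibbs π (energy T L b y) m • (T m).starProjection
      + (gibbs π (energy T L b y) m • (2 * b) •
        innerSL ℝ ((T m).starProjection y - gibbsMixture T π L b y)).smulRight
          ((T m).starProjection y)‖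
      ≤ gibbs π (energy T L b y) m * (1 + 4 * b * ‖y‖ ^ 2) := by
    intro m
    have hw := gibbs_nonneg hπ hsum (energy T L b y) m
    have hP := Submodule.norm_starProjection_apply_le (T m) y
    refine (norm_add_le _ _).trans ?_
    rw [norm_smul, ContinuousLinearMap.norm_smulRight_apply, norm_smul, norm_smul,
      innerSL_apply_norm, Real.norm_of_nonneg hw, Real.norm_of_nonneg (by positivity : 0 ≤ 2 * b)]
    have h1 : ‖(T m).starProjection y - gibbsMixture T π L b y‖ ≤ 2 * ‖y‖ := by
      refine (norm_sub_le _ _).trans ?_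
      linarith [norm_gibbsMixture_le hπ hsum (T := T) (L := L) (b := b) y]
    have h2 : ‖(T m).starProjection‖ ≤ 1 := Submodule.starProjection_norm_le (T m)
    calc _ ≤ gibbs π (energy T L b y) m * 1
        + gibbs π (energy T L b y) m * (2 * b * (2 * ‖y‖)) * ‖y‖ := by gcongr
      _ = _ := by ring
  refine (norm_sum_le _ _).trans ((Finset.sum_le_sum fun m _ => hterm m).trans_eq ?_)
  rw [← Finset.sum_mul, sum_gibbs hπ hsum, one_mul]

/-- Differentiating the projections yields dimensions. Differentiating the weights yields rank-one
maps whose traces add up, by centring, to 2b times the dispersion. -/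
lemma trace_gibbsMixtureDeriv (hπ : ∀ m, 0 ≤ π m) (hsum : ∑ m, π m = 1)
    (y : E) :
    LinearMap.trace ℝ E (gibbsMixtureDeriv T π L b y)
      = ∑ m, gibbs π (energy T L b y) m * Module.finrank ℝ (T m)
        + 2 * b * ∑ m, gibbs π (energy T L b y) m *
          ‖(T m).starProjection y - gibbsMixture T π L b y‖ ^ 2 := by
  have hmean := sum_mul_inner_sub_mean (sum_gibbs hπ hsum (energy T L b y))
    (fun m => (T m).starProjection y)
  change ∑ m, _ * inner ℝ (_ - gibbsMixture T π L b y) _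
    = ∑ m, _ * ‖_ - gibbsMixture T π L b y‖ ^ 2 at hmean
  rw [← hmean, gibbsMixtureDeriv, ContinuousLinearMap.toLinearMap_sum, map_sum, Finset.mul_sum,
    ← Finset.sum_add_distrib]
  refine Finset.sum_congr rfl fun m _ => ?_
  rw [ContinuousLinearMap.toLinearMap_add, map_add, ContinuousLinearMap.toLinearMap_smul, map_smul,
    trace_starProjection, smul_eq_mul]
  congr 1
  refine (LinearMap.trace_smulRight _ _).trans ?_
  simp [inner_sub_left]
  ring

/-- Bound on Stein's unbiased risk estimate by the free energy. -/
lemma sure_le (hπ : ∀ m, 0 ≤ π m) (hsum : ∑ m, π m = 1)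
    (hb : 0 < b) (hL : ∀ m, (Module.finrank ℝ (T m) : ℝ) / 2 ≤ L m) (σ : ℝ)
    (r : M → ℝ) (y : E) :
    ‖y - gibbsMixture T π L b y‖ ^ 2
        + 2 * σ ^ 2 * LinearMap.trace ℝ E (gibbsMixtureDeriv T π L b y)
      ≤ max 1 (4 * b * σ ^ 2) / b * (-Real.log (partition π r)
        + ∑ m, gibbs π r m * (b * ‖y - (T m).starProjection y‖ ^ 2 + L m - r m)) := by
  set w := gibbs π (energy T L b y) with hw
  set κ := max 1 (4 * b * σ ^ 2) with hκ
  set q : M → ℝ := fun m => b * ‖y - (T m).starProjection y‖ ^ 2 + L m with hq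
  have hκ1 : 1 ≤ κ := le_max_left _ _
  have hκ2 : 4 * b * σ ^ 2 ≤ κ := le_max_right _ _
  have hw0 : ∀ m, 0 ≤ w m := gibbs_nonneg hπ hsum _
  have hpyth : ∀ m, ‖y - (T m).starProjection y‖ ^ 2
      = ‖y‖ ^ 2 - ‖(T m).starProjection y‖ ^ 2 := by
    intro m
    have h1 : inner ℝ y ((T m).starProjection y) = ‖(T m).starProjection y‖ ^ 2 := by
      rw [← real_inner_self_eq_norm_sq, Submodule.inner_starProjection_left_eq_right,
        Submodule.starProjection_eq_self_iff.2 (Submodule.starProjection_apply_mem (T m) y)]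
    rw [norm_sub_sq_real, h1]
    ring
  -- By Pythagoras the residual energy differs from `energy` by a constant in the model, so the
  -- weights are unchanged.
  have hwq : w = gibbs π q := by
    have : q = fun m => energy T L b y m + b * ‖y‖ ^ 2 := by
      ext m
      simp only [hq, energy, hpyth]
      ring
    rw [this, gibbs_add_const]
  have hmean := sum_mul_norm_sub_sq (sum_gibbs hπ hsum (energy T L b y))
    (fun m => (T m).starProjection y) y
  change ∑ m, w m * _ = ∑ m, w m * ‖_ - gibbsMixture T π L b y‖ ^ 2
    + ‖y - gibbsMixture T π L b y‖ ^ 2 at hmean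
  rw [trace_gibbsMixtureDeriv hπ hsum, ← hw]
  set V := ∑ m, w m * ‖(T m).starProjection y - gibbsMixture T π L b y‖ ^ 2
  set R := ∑ m, w m * ‖y - (T m).starProjection y‖ ^ 2
  have hV0 : 0 ≤ V := Finset.sum_nonneg fun m _ => mul_nonneg (hw0 m) (sq_nonneg _)
  have hVR : V ≤ R := by
    rw [hmean]; linarith [sq_nonneg ‖y - gibbsMixture T π L b y‖]
  -- The penalty absorbs the dimensions: 2σ² dim ≤ 4σ² L and 4σ² ≤ κ/b.
  have hdim : 2 * σ ^ 2 * ∑ m, w m * Module.finrank ℝ (T m) ≤ κ / b * ∑ m, w m * L m := by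
    rw [Finset.mul_sum, Finset.mul_sum]
    refine Finset.sum_le_sum fun m _ => ?_
    have h1 : 4 * σ ^ 2 ≤ κ / b := by rw [le_div_iff₀ hb]; linarith
    have h2 : 0 ≤ L m := le_trans (by positivity) (hL m)
    calc 2 * σ ^ 2 * (w m * Module.finrank ℝ (T m))
        = w m * (4 * σ ^ 2 * (Module.finrank ℝ (T m) / 2)) := by ring
      _ ≤ w m * (κ / b * L m) :=
          mul_le_mul_of_nonneg_left (mul_le_mul h1 (hL m) (by positivity) (by positivity)) (hw0 m)
      _ = _ := by ring
  have hfree : ∑ m, w m * q m ≤ -Real.log (partition π r) + ∑ m, gibbs π r m * (q m - r m) := by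
    rw [hwq]
    exact (sum_gibbs_mul_le hπ hsum q).trans (neg_log_partition_le hπ hsum q r)
  have hsplit : ∑ m, w m * q m = b * R + ∑ m, w m * L m := by
    rw [Finset.mul_sum, ← Finset.sum_add_distrib]
    exact Finset.sum_congr rfl fun m _ => by simp only [hq]; ring
  -- If 4bσ² ≤ 1 the dispersion term only helps; otherwise V ≤ R turns it into the excess factor κ -
  -- 1.
  have hVκ : (4 * b * σ ^ 2 - 1) * V ≤ (κ - 1) * R :=
    (mul_le_mul_of_nonneg_right (by linarith) hV0).trans
      (mul_le_mul_of_nonneg_left hVR (by linarith))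
  calc _ = R + (4 * b * σ ^ 2 - 1) * V + 2 * σ ^ 2 * ∑ m, w m * Module.finrank ℝ (T m) := by
        rw [hmean]; ring
    _ ≤ R + (κ - 1) * R + κ / b * ∑ m, w m * L m := by linarith
    _ = κ / b * ∑ m, w m * q m := by rw [hsplit]; field_simp; ring
    _ ≤ _ := mul_le_mul_of_nonneg_left hfree (by positivity)

variable [MeasurableSpace E] [BorelSpace E]

/-- Risk of the Gibbs mixture with a deterministic temperature. -/
lemma integral_norm_sub_gibbsMixture_sq_le (hπ : ∀ m, 0 ≤ π m) (hsum : ∑ m, π m = 1)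
    (hb : 0 < b)
    (hL : ∀ m, (Module.finrank ℝ (T m) : ℝ) / 2 ≤ L m) (θ : E) (σ : ℝ) (r : M → ℝ) :
    ∫ x, ‖θ - gibbsMixture T π L b (θ + σ • x)‖ ^ 2 ∂(stdGaussian E)
      ≤ max 1 (4 * b * σ ^ 2) / b * (-Real.log (partition π r)
        + ∑ m, gibbs π r m * (b * (‖θ - (T m).starProjection θ‖ ^ 2
          + ((Module.finrank ℝ E : ℝ) - Module.finrank ℝ (T m)) * σ ^ 2) + L m - r m))
        - Module.finrank ℝ E * σ ^ 2 := by
  set h : E → E := fun x => gibbsMixture T π L b (θ + σ • x) with hh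
  have hGc : Continuous (gibbsMixture T π L b) := continuous_iff_continuousAt.2 fun y =>
    (hasFDerivAt_gibbsMixture hπ hsum y).continuousAt
  have hd : ∀ x, HasFDerivAt h (σ • gibbsMixtureDeriv T π L b (θ + σ • x)) x := by
    intro x
    have h1 : HasFDerivAt (fun x : E => θ + σ • x) (σ • ContinuousLinearMap.id ℝ E) x :=
      ((hasFDerivAt_id x).const_smul σ).const_add θ
    refine ((hasFDerivAt_gibbsMixture hπ hsum (θ + σ • x)).comp x h1).congr_fderiv ?_
    ext v
    simp
  set C₀ := 2 * ‖θ‖ ^ 2 + 2 * σ ^ 2 with hC₀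
  have hC₀0 : 0 ≤ C₀ := by positivity
  have hquad : ∀ x : E, ‖θ + σ • x‖ ^ 2 ≤ C₀ * (1 + ‖x‖ ^ 2) := by
    intro x
    have h1 : ‖θ + σ • x‖ ≤ ‖θ‖ + |σ| * ‖x‖ := (norm_add_le _ _).trans (by rw [norm_smul]; rfl)
    have h2 : ‖θ + σ • x‖ ^ 2 ≤ (‖θ‖ + |σ| * ‖x‖) ^ 2 := by gcongr
    have h3 : |σ| ^ 2 = σ ^ 2 := sq_abs σ
    nlinarith [sq_nonneg (‖θ‖ - |σ| * ‖x‖), sq_nonneg (‖θ‖ * ‖x‖), sq_nonneg σ]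
  obtain ⟨i1, i2, hstein⟩ := integral_inner_stdGaussian_eq_trace hd
    ((1 + C₀) + |σ| * (1 + 4 * b * C₀)) 2
    (fun x => by
      have h1 := norm_gibbsMixture_le hπ hsum (T := T) (L := L) (b := b) (θ + σ • x)
      have h2 : ‖θ + σ • x‖ ≤ 1 + ‖θ + σ • x‖ ^ 2 := by nlinarith [sq_nonneg (‖θ + σ • x‖ - 1)]
      have h3 : 0 ≤ |σ| * (1 + 4 * b * C₀) * (1 + ‖x‖ ^ 2) := by positivity
      have h4 := hquad x
      nlinarith [sq_nonneg ‖x‖])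
    (fun x => by
      rw [norm_smul, Real.norm_eq_abs]
      have h1 := norm_gibbsMixtureDeriv_le hπ hsum (T := T) (L := L) hb.le (θ + σ • x)
      have h2 : 1 + 4 * b * ‖θ + σ • x‖ ^ 2 ≤ (1 + 4 * b * C₀) * (1 + ‖x‖ ^ 2) := by
        have := mul_le_mul_of_nonneg_left (hquad x) (by positivity : 0 ≤ 4 * b)
        nlinarith [sq_nonneg ‖x‖]
      have h3 : 0 ≤ (1 + C₀) * (1 + ‖x‖ ^ 2) := by positivity
      have h4 := mul_le_mul_of_nonneg_left (h1.trans h2) (abs_nonneg σ)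
      nlinarith)
  simp only [ContinuousLinearMap.toLinearMap_smul, map_smul, smul_eq_mul] at i2 hstein
  have i3 : Integrable (fun x => ‖(θ + σ • x) - h x‖ ^ 2) (stdGaussian E) := by
    refine Integrable.mono' ((integrable_norm_add_smul_sq θ σ).const_mul 4)
      (Continuous.aestronglyMeasurable (by fun_prop)) (Filter.Eventually.of_forall fun x => ?_)
    rw [Real.norm_of_nonneg (by positivity)]
    have h1 : ‖(θ + σ • x) - h x‖ ≤ 2 * ‖θ + σ • x‖ := by
      refine (norm_sub_le _ _).trans ?_
      linarith [norm_gibbsMixture_le hπ hsum (T := T) (L := L) (b := b) (θ + σ • x)]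
    calc _ ≤ (2 * ‖θ + σ • x‖) ^ 2 := by gcongr
      _ = _ := by ring
  -- Recentring at the observation isolates the cross term to which Stein's identity applies.
  have e : ∀ x, ‖θ - h x‖ ^ 2 = ‖(θ + σ • x) - h x‖ ^ 2 + 2 * σ * inner ℝ x (h x)
      - 2 * σ * inner ℝ θ x - σ ^ 2 * ‖x‖ ^ 2 := by
    intro x
    have h1 : (θ + σ • x) - h x = (θ - h x) + σ • x := by abel
    rw [h1, norm_add_sq_real, inner_smul_right, norm_smul, mul_pow, Real.norm_eq_abs, sq_abs,
      inner_sub_left, real_inner_comm x (h x)]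
    ring
  have i4 : Integrable (fun x : E => 2 * σ * inner ℝ θ x) (stdGaussian E) :=
    (integrable_inner_const_stdGaussian θ).const_mul _
  have i5 : Integrable (fun x : E => σ ^ 2 * ‖x‖ ^ 2) (stdGaussian E) :=
    (integrable_norm_pow_stdGaussian 2).const_mul _
  have i1' : Integrable (fun x => 2 * σ * inner ℝ x (h x)) (stdGaussian E) := i1.const_mul _
  have i31 : Integrable (fun x => ‖(θ + σ • x) - h x‖ ^ 2 + 2 * σ * inner ℝ x (h x))
    (stdGaussian E) := i3.add i1'
  have i314 : Integrable (fun x => ‖(θ + σ • x) - h x‖ ^ 2 + 2 * σ * inner ℝ x (h x)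
    - 2 * σ * inner ℝ θ x) (stdGaussian E) := i31.sub i4
  have hrisk : ∫ x, ‖θ - h x‖ ^ 2 ∂(stdGaussian E)
      = ∫ x, (‖(θ + σ • x) - h x‖ ^ 2
          + 2 * σ * (σ * LinearMap.trace ℝ E (gibbsMixtureDeriv T π L b (θ + σ • x))))
          ∂(stdGaussian E) - Module.finrank ℝ E * σ ^ 2 := by
    simp_rw [e]
    rw [integral_sub i314 i5, integral_sub i31 i4, integral_add i3 i1', integral_const_mul,
      integral_const_mul, integral_const_mul, hstein, integral_inner_const_stdGaussian,
      integral_norm_sq_stdGaussian, integral_add i3 (i2.const_mul _),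
      integral_const_mul (2 * σ)]
    ring
  rw [hrisk]
  gcongr
  set κ := max 1 (4 * b * σ ^ 2)
  have i6 : ∀ m, Integrable (fun x => gibbs π r m * (b * ‖(θ + σ • x)
      - (T m).starProjection (θ + σ • x)‖ ^ 2 + L m - r m)) (stdGaussian E) := fun m =>
    (((((integral_norm_sub_starProjection_sq (T m) θ σ).1).const_mul b).add
      (integrable_const _)).sub (integrable_const _)).const_mul _
  have i7 : Integrable (fun x => ∑ m, gibbs π r m * (b * ‖(θ + σ • x)
      - (T m).starProjection (θ + σ • x)‖ ^ 2 + L m - r m)) (stdGaussian E) :=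
    integrable_finsetSum _ fun m _ => i6 m
  calc _ ≤ ∫ x, κ / b * (-Real.log (partition π r) + ∑ m, gibbs π r m * (b * ‖(θ + σ • x)
      - (T m).starProjection (θ + σ • x)‖ ^ 2 + L m - r m)) ∂(stdGaussian E) := by
        refine integral_mono (i3.add (i2.const_mul _))
          (((integrable_const _).add i7).const_mul _) fun x => ?_
        refine le_of_eq_of_le ?_ (sure_le hπ hsum hb hL σ r (θ + σ • x))
        simp only [hh]
        ring
    _ = _ := by
        rw [integral_const_mul, integral_add (integrable_const _) i7,
          integral_finsetSum _ fun m _ => i6 m]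
        simp only [integral_const, probReal_univ, one_smul]
        congr 2
        refine Finset.sum_congr rfl fun m _ => ?_
        obtain ⟨j1, j2⟩ := integral_norm_sub_starProjection_sq (T m) θ σ
        have j3 : Integrable (fun x => b * ‖(θ + σ • x)
            - (T m).starProjection (θ + σ • x)‖ ^ 2) (stdGaussian E) := j1.const_mul b
        have j4 : Integrable (fun x => b * ‖(θ + σ • x)
            - (T m).starProjection (θ + σ • x)‖ ^ 2 + L m) (stdGaussian E) :=
          j3.add (integrable_const _)
        rw [integral_const_mul, integral_sub j4 (integrable_const _),
          integral_add j3 (integrable_const _), integral_const_mul, j2]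
        simp

end ConditionalRisk

/-! ### Compatibility of projections with the splitting into a subspace and its orthogonal. -/

section Reduction

variable {E : Type*} [NormedAddCommGroup E] [InnerProductSpace ℝ E]

lemma norm_coe_add_coe_orthogonal_sq (K : Submodule ℝ E) (x : K) (u : Kᗮ) :
    ‖(x : E) + u‖ ^ 2 = ‖x‖ ^ 2 + ‖u‖ ^ 2 := by
  rw [norm_add_sq_real, Submodule.inner_right_of_mem_orthogonal x.2 u.2]
  simp

variable [FiniteDimensional ℝ E]

lemma coe_starProjection_comap {S K : Submodule ℝ E} (h : S ≤ K) (x : K) :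
    (((S.comap K.subtype).starProjection x : K) : E) = S.starProjection (x : E) := by
  refine (Submodule.eq_starProjection_of_mem_of_inner_eq_zero ?_ fun z hz => ?_).symm
  · exact Submodule.starProjection_apply_mem (S.comap K.subtype) x
  · exact Submodule.starProjection_inner_eq_zero (K := S.comap K.subtype) x ⟨z, h hz⟩ hz

lemma starProjection_add_orthogonal {S K : Submodule ℝ E} (h : S ≤ K) (x : K) (u : Kᗮ) :
    S.starProjection ((x : E) + u) = S.starProjection (x : E) := by
  rw [map_add, (Submodule.starProjection_apply_eq_zero_iff S).2 (Submodule.orthogonal_le h u.2),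
    add_zero]

lemma stdGaussian_singleton [MeasurableSpace E] [BorelSpace E] [Nontrivial E] (x : E) :
    stdGaussian E {x} = 0 := by
  rw [stdGaussian_eq_withDensity]
  exact withDensity_absolutelyContinuous _ _ (measure_singleton x)

end Reduction

/-! ### Averaging over the random temperature. -/

section IntegratedRisk

/-- The scalar inequality separating the free energy at the mean variance from the effect of a
small variance estimate. -/
lemma free_energy_scaling {β s t σ A B : ℝ} (hs : 0 < s) (hσ : 0 < σ) (hst : σ ^ 2 ≤ t)
    (hβ0 : 0 < β) (hβ : β < 1 / 4) (hBA : β * B / t ≤ A) :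
    max 1 (4 * (β / s) * σ ^ 2) / (β / s) * (A + B * (β / s - β / t))
      ≤ 1 / β * (s * A + β * B * (1 - s / t)) + max (4 * β * σ ^ 2 / s - 1) 0 * (t * A / β) := by
  have ht : 0 < t := lt_of_lt_of_le (by positivity) hst
  have hmax : max 1 (4 * (β / s) * σ ^ 2) = 1 + max (4 * β * σ ^ 2 / s - 1) 0 := by
    rw [← max_add_add_left, max_comm]
    congr 1 <;> ring
  rw [hmax]
  set κ := max (4 * β * σ ^ 2 / s - 1) 0 with hκ
  have e : (1 + κ) / (β / s) * (A + B * (β / s - β / t))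
      = 1 / β * (s * A + β * B * (1 - s / t)) + κ * ((s * A + β * B * (1 - s / t)) / β) := by
    field_simp
  rw [e]
  refine add_le_add_right ?_ _
  rcases le_or_gt (4 * β * σ ^ 2 / s - 1) 0 with h | h
  · rw [hκ, max_eq_right h, zero_mul, zero_mul]
  · have hκ0 : 0 ≤ κ := le_max_right _ _
    -- The excess κ is positive only if s < 4βσ² < σ² ≤ t, which uses β < 1/4. Then βB/t ≤ A bounds
    -- the bracket by tA.
    have hlt : s < t := by
      have h1 : 1 < 4 * β * σ ^ 2 / s := by linarith
      rw [one_lt_div hs] at h1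
      nlinarith [sq_pos_of_pos hσ]
    gcongr
    have h2 := mul_le_mul_of_nonneg_right hBA (sub_nonneg.2 hlt.le)
    have h3 : β * B / t * (t - s) = β * B * (1 - s / t) := by field_simp
    rw [h3] at h2
    linarith

variable {E : Type*} [NormedAddCommGroup E] [InnerProductSpace ℝ E] [FiniteDimensional ℝ E]
  [MeasurableSpace E] [BorelSpace E]

/-- Removes the null event of a zero variance estimate, where β/0 = 0 and the fixed-temperature
bound, which needs b > 0, does not apply. -/
lemma ae_norm_add_smul_sq_ne_zero [Nontrivial E] (ν : E) {σ : ℝ} (hσ : 0 < σ) :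
    ∀ᵐ u ∂(stdGaussian E), ‖ν + σ • u‖ ^ 2 ≠ 0 := by
  have h0 : ∀ᵐ u ∂(stdGaussian E), u ≠ -(σ⁻¹ • ν) :=
    compl_mem_ae_iff.2 (stdGaussian_singleton (-(σ⁻¹ • ν)))
  filter_upwards [h0] with u hu h
  apply hu
  have h1 : ν + σ • u = 0 := by simpa using h
  rw [eq_neg_of_add_eq_zero_right (a := σ⁻¹ • ν) (b := u)]
  rw [← smul_right_injective E hσ.ne' |>.eq_iff]
  simp only [smul_add, smul_smul, mul_inv_cancel₀ hσ.ne', one_smul, smul_zero]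
  exact h1

/-- The normalized form of the bound on the positive part of the inverse variance estimate. -/
lemma integral_inv_variance_posPart_le_epsilonN (ν : E) {a σ : ℝ} (hσ : 0 < σ) (h0 : 0 < a)
    (h1 : a < 1) {n : ℕ} (hn : 3 ≤ n) (hN : 2 + Real.log n / phi a ≤ Module.finrank ℝ E) :
    Integrable (fun u => max (a * σ ^ 2 / (‖ν + σ • u‖ ^ 2 / Module.finrank ℝ E) - 1) 0)
      (stdGaussian E) ∧
    ∫ u, max (a * σ ^ 2 / (‖ν + σ • u‖ ^ 2 / Module.finrank ℝ E) - 1) 0 ∂(stdGaussian E)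
      ≤ epsilonN n := by
  have e : ∀ u : E, a * σ ^ 2 / (‖ν + σ • u‖ ^ 2 / Module.finrank ℝ E)
      = a * Module.finrank ℝ E / ‖σ⁻¹ • ν + u‖ ^ 2 := by
    intro u
    have e1 : ν + σ • u = σ • (σ⁻¹ • ν + u) := by
      rw [smul_add, smul_smul, mul_inv_cancel₀ hσ.ne', one_smul]
    rw [e1, norm_smul, mul_pow, Real.norm_eq_abs, sq_abs, div_div_eq_mul_div,
      mul_right_comm, mul_comm (a * (Module.finrank ℝ E : ℝ)),
      mul_div_mul_left _ _ (by positivity)]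
  simp_rw [e]
  exact integral_inv_norm_add_sq_posPart_le_epsilonN (σ⁻¹ • ν) h0 h1 hn hN

variable {F : Type*} [NormedAddCommGroup F] [InnerProductSpace ℝ F] [FiniteDimensional ℝ F]
  [MeasurableSpace F] [BorelSpace F]

/-- Risk of the Gibbs mixture whose temperature is an independent variance estimate. -/
lemma integral_integral_norm_sub_gibbsMixture_sq_le {M : Type*} [Fintype M]
    {T : M → Submodule ℝ E} {π L : M → ℝ} {β σ t : ℝ} {n : ℕ} (hn : 3 ≤ n) (θ : E) (ν : F)
    (hσ : 0 < σ) (hπ : ∀ m, 0 ≤ π m) (hsum : ∑ m, π m = 1)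
    (hL : ∀ m, (Module.finrank ℝ (T m) : ℝ) / 2 ≤ L m) (hβ0 : 0 < β) (hβ : β < 1 / 4)
    (hN : 2 + Real.log n / phi (4 * β) ≤ Module.finrank ℝ F)
    (ht : t = σ ^ 2 + ‖ν‖ ^ 2 / Module.finrank ℝ F) (r : M → ℝ)
    (hr : r = fun m => β * (‖θ - (T m).starProjection θ‖ ^ 2
      + ((Module.finrank ℝ E : ℝ) - Module.finrank ℝ (T m)) * σ ^ 2) / t + L m)
    (hint : Integrable (fun u => ∫ x, ‖θ - gibbsMixture T π L
      (β / (‖ν + σ • u‖ ^ 2 / Module.finrank ℝ F)) (θ + σ • x)‖ ^ 2 ∂(stdGaussian E))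
      (stdGaussian F)) :
    ∫ u, ∫ x, ‖θ - gibbsMixture T π L (β / (‖ν + σ • u‖ ^ 2 / Module.finrank ℝ F))
        (θ + σ • x)‖ ^ 2 ∂(stdGaussian E) ∂(stdGaussian F)
      ≤ (1 + epsilonN n) * (t * -Real.log (partition π r) / β) - Module.finrank ℝ E * σ ^ 2 := by
  set N : ℝ := (Module.finrank ℝ F : ℝ) with hNdef
  set d : ℝ := (Module.finrank ℝ E : ℝ) with hd
  have hn' : (3 : ℝ) ≤ n := by exact_mod_cast hn
  have hlog : 0 < Real.log n := Real.log_pos (by linarith)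
  have hphi : 0 < phi (4 * β) := phi_pos (by linarith) (by linarith)
  have hN0 : 0 < N := by
    have : 0 < Real.log n / phi (4 * β) := by positivity
    linarith
  have hσt : σ ^ 2 ≤ t := by
    rw [ht]
    have : 0 ≤ ‖ν‖ ^ 2 / N := by positivity
    linarith
  have ht0 : 0 < t := lt_of_lt_of_le (by positivity) hσt
  set a : M → ℝ := fun m => ‖θ - (T m).starProjection θ‖ ^ 2
    + (d - Module.finrank ℝ (T m)) * σ ^ 2 with ha
  have ha0 : ∀ m, 0 ≤ a m := fun m => by
    have : (Module.finrank ℝ (T m) : ℝ) ≤ d := Nat.cast_le.2 (Submodule.finrank_le (T m))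
    have h2 : 0 ≤ (d - Module.finrank ℝ (T m)) * σ ^ 2 :=
      mul_nonneg (by linarith) (sq_nonneg σ)
    positivity
  set A : ℝ := -Real.log (partition π r) with hA
  set B : ℝ := ∑ m, gibbs π r m * a m with hB
  have hv0 := gibbs_nonneg hπ hsum r
  have hB0 : 0 ≤ B := Finset.sum_nonneg fun m _ => mul_nonneg (hv0 m) (ha0 m)
  have hBA : β * B / t ≤ A := by
    refine le_trans ?_ (sum_gibbs_mul_le hπ hsum r)
    rw [hB, Finset.mul_sum, Finset.sum_div]
    refine Finset.sum_le_sum fun m _ => ?_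
    have h1 : 0 ≤ L m := le_trans (by positivity) (hL m)
    have h2 : β * a m / t ≤ r m := by rw [hr]; exact le_add_of_nonneg_right h1
    calc β * (gibbs π r m * a m) / t = gibbs π r m * (β * a m / t) := by ring
      _ ≤ gibbs π r m * r m := mul_le_mul_of_nonneg_left h2 (hv0 m)
  have hA0 : 0 ≤ A := le_trans (by positivity) hBA
  set s : F → ℝ := fun u => ‖ν + σ • u‖ ^ 2 / N with hs
  set κ : F → ℝ := fun u => max (4 * β * σ ^ 2 / s u - 1) 0 with hκ
  have hcond : ∀ u, s u ≠ 0 → ∫ x, ‖θ - gibbsMixture T π L (β / s u) (θ + σ • x)‖ ^ 2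
      ∂(stdGaussian E) ≤ (1 / β * (s u * A + β * B * (1 - s u / t)) + κ u * (t * A / β))
        - d * σ ^ 2 := by
    intro u hu
    have hsu : 0 < s u := lt_of_le_of_ne (by simp only [hs]; positivity) hu.symm
    have h1 := integral_norm_sub_gibbsMixture_sq_le hπ hsum (b := β / s u) (by positivity) hL θ σ r
    -- The choice of `r` cancels the penalties and leaves a multiple of β/s - β/t, with the same
    -- coefficient B for all u.
    have h2 : ∑ m, gibbs π r m * (β / s u * (‖θ - (T m).starProjection θ‖ ^ 2
          + (d - Module.finrank ℝ (T m)) * σ ^ 2) + L m - r m)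
        = B * (β / s u - β / t) := by
      rw [hB, Finset.sum_mul]
      refine Finset.sum_congr rfl fun m _ => ?_
      have h3 : r m = β * a m / t + L m := by rw [hr]
      rw [h3]
      simp only [ha]
      ring
    rw [h2, ← hA] at h1
    exact h1.trans (sub_le_sub_right (free_energy_scaling hsu hσ hσt hβ0 hβ hBA) _)
  have hnontriv : Nontrivial F := Module.nontrivial_of_finrank_pos (R := ℝ) (Nat.cast_pos.1 hN0)
  have hae : ∀ᵐ u ∂(stdGaussian F), s u ≠ 0 :=
    (ae_norm_add_smul_sq_ne_zero ν hσ).mono fun u hu => div_ne_zero hu hN0.ne'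
  obtain ⟨hκi, hκle⟩ := integral_inv_variance_posPart_le_epsilonN ν hσ
    (a := 4 * β) (by linarith) (by linarith) hn hN
  have hsi : Integrable s (stdGaussian F) := (integrable_norm_add_smul_sq ν σ).div_const N
  -- This is why σ̄² is the reference temperature: 1 - s/t then has mean zero and the B term
  -- disappears.
  have hsint : ∫ u, s u ∂(stdGaussian F) = t := by
    simp only [hs]
    rw [integral_div, integral_norm_add_smul_sq, ht, ← hNdef]
    field_simp
    ring
  have i1 : Integrable (fun u => s u * A) (stdGaussian F) := hsi.mul_const A
  have i2 : Integrable (fun u => 1 - s u / t) (stdGaussian F) :=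
    (integrable_const _).sub (hsi.div_const t)
  have i3 : Integrable (fun u => 1 / β * (s u * A + β * B * (1 - s u / t)))
    (stdGaussian F) := (i1.add (i2.const_mul _)).const_mul _
  have i4 : Integrable (fun u => κ u * (t * A / β)) (stdGaussian F) := hκi.mul_const _
  have i5 : Integrable (fun u => 1 / β * (s u * A + β * B * (1 - s u / t)) + κ u * (t * A / β))
    (stdGaussian F) := i3.add i4
  calc _ ≤ ∫ u, ((1 / β * (s u * A + β * B * (1 - s u / t)) + κ u * (t * A / β))
        - d * σ ^ 2) ∂(stdGaussian F) :=
        integral_mono_ae hint (i5.sub (integrable_const _)) (hae.mono hcond)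
    _ = (1 + ∫ u, κ u ∂(stdGaussian F)) * (t * A / β) - d * σ ^ 2 := by
        rw [integral_sub i5 (integrable_const _), integral_add i3 i4,
          integral_const_mul, integral_add i1 (i2.const_mul _), integral_mul_const,
          integral_const_mul, integral_sub (integrable_const _) (hsi.div_const t),
          integral_div t, integral_mul_const, hsint, div_self ht0.ne']
        simp only [integral_const, probReal_univ, one_smul]
        ring
    _ ≤ _ := by gcongr

end IntegratedRisk

/-! ### Back to the mixed estimator and its two risk bounds. -/

section Estimator

lemma epsilonN_nonneg (n : ℕ) : 0 ≤ epsilonN n := by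
  have := Real.log_natCast_nonneg n
  unfold epsilonN
  positivity

/-- The two energies differ by the constant β(dσ² - v)/t. Outside the logarithm it cancels -dσ² + v
up to ε_n(dσ² - v), which is at most ε_n nσ² = σ²/(2 log n). -/
lemma gibbs_bound_of_free_energy {n : ℕ} (hn : 3 ≤ n) {M : Type*} [Fintype M] {π L : M → ℝ}
    {β σ t d v : ℝ} (hπ : ∀ m, 0 ≤ π m) (hsum : ∑ m, π m = 1) (hβ : 0 < β) (ht : 0 < t)
    (hv : 0 ≤ v) (hd : d ≤ n) (D δ : M → ℝ) :
    (1 + epsilonN n) * (t * -Real.log (partition π fun m =>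
        β * (D m - v + (d - δ m) * σ ^ 2) / t + L m) / β) - d * σ ^ 2 + v
      ≤ -(1 + epsilonN n) * (t / β) * Real.log (∑ m, π m * Real.exp
          (-β * (D m - δ m * σ ^ 2) / t - L m)) + σ ^ 2 / (2 * Real.log n) := by
  have hr : (fun m => β * (D m - v + (d - δ m) * σ ^ 2) / t + L m)
      = fun m => (β * (D m - δ m * σ ^ 2) / t + L m) + β * (d * σ ^ 2 - v) / t := by
    ext m
    ring
  have hp : ∑ m, π m * Real.exp (-β * (D m - δ m * σ ^ 2) / t - L m)
      = partition π fun m => β * (D m - δ m * σ ^ 2) / t + L m := by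
    refine Finset.sum_congr rfl fun m _ => ?_
    congr 2
    ring
  rw [hr, hp, partition_add_const, Real.log_mul (Real.exp_pos _).ne'
    (partition_pos hπ hsum _).ne', Real.log_exp]
  set ℓ := Real.log (partition π fun m => β * (D m - δ m * σ ^ 2) / t + L m)
  have e : t * -(-(β * (d * σ ^ 2 - v) / t) + ℓ) / β = d * σ ^ 2 - v - t / β * ℓ := by
    field_simp
    ring
  have hn' : (3 : ℝ) ≤ n := by exact_mod_cast hn
  have hlog : 0 < Real.log n := Real.log_pos (by linarith)
  have hεn : epsilonN n * (n * σ ^ 2) = σ ^ 2 / (2 * Real.log n) := by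
    unfold epsilonN
    field_simp
  have h1 : epsilonN n * (d * σ ^ 2 - v) ≤ epsilonN n * (n * σ ^ 2) := by
    refine mul_le_mul_of_nonneg_left ?_ (epsilonN_nonneg n)
    have := mul_le_mul_of_nonneg_right hd (sq_nonneg σ)
    linarith
  rw [e, ← hεn]
  linarith

/-- One summand bounds the sum from below, and the favourable dimension term δ is dropped. -/
lemma neg_log_sum_le_term {M : Type*} [Fintype M] {π : M → ℝ} {β t : ℝ} (hπ : ∀ m, 0 ≤ π m)
    (hβ : 0 < β) (ht : 0 < t) (L D δ : M → ℝ) (hδ : ∀ m, 0 ≤ δ m) {m : M} (hm : 0 < π m) :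
    -(t / β * Real.log (∑ k, π k * Real.exp (-β * (D k - δ k) / t - L k)))
      ≤ D m + t / β * (L m - Real.log (π m)) := by
  have h1 : π m * Real.exp (-β * (D m - δ m) / t - L m)
      ≤ ∑ k, π k * Real.exp (-β * (D k - δ k) / t - L k) :=
    Finset.single_le_sum (f := fun k => π k * Real.exp (-β * (D k - δ k) / t - L k))
      (fun k _ => mul_nonneg (hπ k) (Real.exp_nonneg _)) (Finset.mem_univ m)
  have h2 := Real.log_le_log (mul_pos hm (Real.exp_pos _)) h1
  rw [Real.log_mul hm.ne' (Real.exp_pos _).ne', Real.log_exp] at h2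
  have h3 := mul_le_mul_of_nonneg_left h2 (show 0 ≤ t / β by positivity)
  have h4 : t / β * (Real.log (π m) + (-β * (D m - δ m) / t - L m))
      = -(D m - δ m) - t / β * (L m - Real.log (π m)) := by
    field_simp
    ring
  linarith [hδ m]

variable {n : ℕ} {M : Type*} [Fintype M] {S : M → Submodule ℝ (Vec n)}
  {Sstar : Submodule ℝ (Vec n)} {π L : M → ℝ} {β : ℝ}

lemma observation_eq (μ : Vec n) (σ : ℝ) (e : Fin n → ℝ) :
    observation μ σ e = μ + σ • WithLp.toLp 2 e := by
  ext i
  simp [observation]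

lemma residualDim_eq (K : Submodule ℝ (Vec n)) : residualDim K = Module.finrank ℝ Kᗮ := by
  have h := K.finrank_add_finrank_orthogonal
  rw [finrank_euclideanSpace_fin] at h
  have h' : (Module.finrank ℝ K : ℝ) + Module.finrank ℝ Kᗮ = n := by exact_mod_cast h
  rw [residualDim]
  linarith

lemma varianceEstimator_add (x : Sstar) (u : Sstarᗮ) :
    varianceEstimator Sstar ((x : Vec n) + u) = ‖u‖ ^ 2 / Module.finrank ℝ Sstarᗮ := by
  rw [varianceEstimator, residualDim_eq, starProjection_add_orthogonal le_rfl,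
    Submodule.starProjection_eq_self_iff.2 x.2]
  simp

/-- The mixed estimator is a Gibbs mixture inside `S_*`, the temperature depending only on the
residual. -/
lemma mixedEstimator_add (hS : ∀ m, S m ≤ Sstar) (x : Sstar) (u : Sstarᗮ) :
    mixedEstimator S Sstar π L β ((x : Vec n) + u)
      = (gibbsMixture (fun m => (S m).comap Sstar.subtype) π L
          (β / (‖u‖ ^ 2 / Module.finrank ℝ Sstarᗮ)) x : Sstar) := by
  have hP : ∀ m, leastSquares (S m) ((x : Vec n) + u)
      = (((S m).comap Sstar.subtype).starProjection x : Sstar) := fun m => by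
    rw [leastSquares, starProjection_add_orthogonal (hS m), coe_starProjection_comap (hS m)]
  -- Regrouping βc/s as (β/s)c is also valid at s = 0, where both sides are zero, so no case on u is
  -- needed.
  have hraw : ∀ m, rawWeight S Sstar π L β ((x : Vec n) + u) m
      = π m * Real.exp (-energy (fun m => (S m).comap Sstar.subtype) L
          (β / (‖u‖ ^ 2 / Module.finrank ℝ Sstarᗮ)) x m) := fun m => by
    rw [rawWeight, varianceEstimator_add, energy, hP, ← Submodule.coe_norm]
    congr 2
    ring
  rw [mixedEstimator, gibbsMixture, Submodule.coe_sum]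
  refine Finset.sum_congr rfl fun m _ => ?_
  rw [Submodule.coe_smul, hP, weight, gibbs, partition]
  simp_rw [hraw]

/-- A convex combination of projections is no longer than y, whatever the variance estimate. This
gives integrability of the loss without control of small variances. -/
lemma norm_mixedEstimator_le (hS : ∀ m, S m ≤ Sstar) (hπ : ∀ m, 0 ≤ π m) (hsum : ∑ m, π m = 1)
    (y : Vec n) : ‖mixedEstimator S Sstar π L β y‖ ≤ ‖y‖ := by
  set x : Sstar := ⟨Sstar.starProjection y, Submodule.starProjection_apply_mem _ _⟩
  set u : Sstarᗮ := ⟨y - Sstar.starProjection y, Submodule.sub_starProjection_mem_orthogonal y⟩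
  have hy : y = (x : Vec n) + u := by simp [x, u]
  have h := mixedEstimator_add (π := π) (L := L) (β := β) hS x u
  rw [← hy] at h
  rw [h, Submodule.coe_norm]
  refine (norm_gibbsMixture_le hπ hsum x).trans ?_
  exact Submodule.norm_starProjection_apply_le Sstar y

lemma measurable_mixedEstimator : Measurable (mixedEstimator S Sstar π L β) := by
  unfold mixedEstimator weight rawWeight varianceEstimator leastSquares
  fun_prop

lemma integrable_norm_sub_mixedEstimator_sq (hS : ∀ m, S m ≤ Sstar) (hπ : ∀ m, 0 ≤ π m)
    (hsum : ∑ m, π m = 1) (μ : Vec n) (σ : ℝ) :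
    Integrable (fun z => ‖μ - mixedEstimator S Sstar π L β (μ + σ • z)‖ ^ 2)
      (stdGaussian (Vec n)) := by
  have hm : Measurable (fun z : Vec n => ‖μ - mixedEstimator S Sstar π L β (μ + σ • z)‖ ^ 2) := by
    have := measurable_mixedEstimator (S := S) (Sstar := Sstar) (π := π) (L := L) (β := β)
    fun_prop
  refine Integrable.mono' (g := fun z => 2 * ‖μ‖ ^ 2 + 2 * ‖μ + σ • z‖ ^ 2)
    ((integrable_const _).add ((integrable_norm_add_smul_sq μ σ).const_mul 2))
    hm.aestronglyMeasurable (Filter.Eventually.of_forall fun z => ?_)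
  rw [Real.norm_of_nonneg (by positivity)]
  have h1 : ‖μ - mixedEstimator S Sstar π L β (μ + σ • z)‖ ≤ ‖μ‖ + ‖μ + σ • z‖ :=
    (norm_sub_le _ _).trans (by gcongr; exact norm_mixedEstimator_le hS hπ hsum _)
  have h2 : ‖μ - mixedEstimator S Sstar π L β (μ + σ • z)‖ ^ 2 ≤ (‖μ‖ + ‖μ + σ • z‖) ^ 2 := by
    gcongr
  nlinarith [sq_nonneg (‖μ‖ - ‖μ + σ • z‖)]

lemma norm_sub_starProjection_sq_add {S K : Submodule ℝ (Vec n)} (h : S ≤ K) (θ : K) (ν : Kᗮ) :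
    ‖((θ : Vec n) + ν) - S.starProjection ((θ : Vec n) + ν)‖ ^ 2
      = ‖θ - (S.comap K.subtype).starProjection θ‖ ^ 2 + ‖ν‖ ^ 2 := by
  rw [← norm_coe_add_coe_orthogonal_sq, starProjection_add_orthogonal h,
    ← coe_starProjection_comap h, Submodule.coe_sub]
  congr 2
  abel

/-- The risk bound for the standard Gaussian measure. -/
lemma integral_norm_sub_mixedEstimator_sq_le (hn : 3 ≤ n) (μ : Vec n) {σ : ℝ} (hσ : 0 < σ)
    (hS : ∀ m, S m ≤ Sstar) (hπ : ∀ m, 0 ≤ π m) (hsum : ∑ m, π m = 1)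
    (hL : ∀ m, (Module.finrank ℝ (S m) : ℝ) / 2 ≤ L m) (hβ0 : 0 < β) (hβ : β < 1 / 4)
    (hN : 2 + Real.log n / phi (4 * β) ≤ residualDim Sstar) :
    ∫ z, ‖μ - mixedEstimator S Sstar π L β (μ + σ • z)‖ ^ 2 ∂(stdGaussian (Vec n))
      ≤ gibbsBound S Sstar π L β μ σ := by
  rw [residualDim_eq] at hN
  obtain ⟨θ, ν, hμ⟩ : ∃ (θ : Sstar) (ν : Sstarᗮ), μ = (θ : Vec n) + ν :=
    ⟨⟨Sstar.starProjection μ, Submodule.starProjection_apply_mem _ _⟩,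
      ⟨μ - Sstar.starProjection μ, Submodule.sub_starProjection_mem_orthogonal μ⟩, by simp⟩
  have hdimT : ∀ m, Module.finrank ℝ ((S m).comap Sstar.subtype) = Module.finrank ℝ (S m) :=
    fun m => (Submodule.comapSubtypeEquivOfLe (hS m)).finrank_eq
  -- The estimator lies in `Sstar`, so by Pythagoras the component `ν` of the mean adds a constant
  -- to the loss.
  have hfx : ∀ (x : Sstar) (u : Sstarᗮ),
      ‖μ - mixedEstimator S Sstar π L β (μ + σ • ((x : Vec n) + u))‖ ^ 2
        = ‖θ - gibbsMixture (fun m => (S m).comap Sstar.subtype) π L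
            (β / (‖ν + σ • u‖ ^ 2 / Module.finrank ℝ Sstarᗮ)) (θ + σ • x)‖ ^ 2 + ‖ν‖ ^ 2 := by
    intro x u
    have e1 : μ + σ • ((x : Vec n) + u) = ((θ + σ • x : Sstar) : Vec n) + (ν + σ • u : Sstarᗮ) := by
      push_cast
      rw [hμ, smul_add]
      abel
    rw [e1, mixedEstimator_add hS, ← norm_coe_add_coe_orthogonal_sq, Submodule.coe_sub, hμ]
    congr 2
    abel
  have hfint := integrable_norm_sub_mixedEstimator_sq (L := L) (β := β) hS hπ hsum μ σ
  have hmap : Measurable (fun p : Sstar × Sstarᗮ => (p.1 : Vec n) + (p.2 : Vec n)) := by fun_prop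
  rw [stdGaussian_eq_map_prod Sstar] at hfint ⊢
  have hprod := hfint.comp_measurable hmap
  rw [integral_map hmap.aemeasurable hfint.1]
  simp only [Function.comp_def, hfx] at hprod ⊢
  have hprod' : Integrable (fun p : Sstar × Sstarᗮ =>
      ‖θ - gibbsMixture (fun m => (S m).comap Sstar.subtype) π L
        (β / (‖ν + σ • p.2‖ ^ 2 / Module.finrank ℝ Sstarᗮ)) (θ + σ • p.1)‖ ^ 2)
      ((stdGaussian Sstar).prod (stdGaussian Sstarᗮ)) := by
    refine (hprod.sub (integrable_const (‖ν‖ ^ 2))).congr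
      (Filter.Eventually.of_forall fun p => ?_)
    exact add_sub_cancel_right _ _
  -- Fubini with the residual noise outside, so that the temperature is frozen in the inner
  -- integral.
  rw [integral_add hprod' (integrable_const _), integral_prod_symm _ hprod']
  have hvar : sigmaBarSq Sstar μ σ = σ ^ 2 + ‖ν‖ ^ 2 / Module.finrank ℝ Sstarᗮ := by
    rw [sigmaBarSq, residualDim_eq, hμ, starProjection_add_orthogonal le_rfl,
      Submodule.starProjection_eq_self_iff.2 θ.2]
    simp
  have hrisk := integral_integral_norm_sub_gibbsMixture_sq_le hn θ ν hσ hπ hsum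
    (fun m => by rw [hdimT]; exact hL m) hβ0 hβ hN hvar _ rfl hprod'.integral_prod_right
  have hbias : ∀ m, ‖θ - ((S m).comap Sstar.subtype).starProjection θ‖ ^ 2
      = ‖μ - (S m).starProjection μ‖ ^ 2 - ‖ν‖ ^ 2 := fun m => by
    rw [hμ, norm_sub_starProjection_sq_add (hS m), add_sub_cancel_right]
  simp only [hbias, hdimT] at hrisk
  have hdn : (Module.finrank ℝ Sstar : ℝ) ≤ n := by
    have := Submodule.finrank_le Sstar
    rw [finrank_euclideanSpace_fin] at this
    exact Nat.cast_le.2 this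
  have ht0 : 0 < sigmaBarSq Sstar μ σ := by
    rw [hvar]
    positivity
  simp only [integral_const, probReal_univ, one_smul]
  refine (add_le_add_left hrisk _).trans ?_
  rw [gibbsBound]
  exact gibbs_bound_of_free_energy hn hπ hsum hβ0 ht0 (sq_nonneg ‖ν‖) hdn _ _

lemma gibbsBound_le_oracleBound (μ : Vec n) {σ : ℝ} (hσ : 0 < σ)
    (hπ : ∀ m, 0 ≤ π m) (hsum : ∑ m, π m = 1) (hβ0 : 0 < β) (hN : 0 < residualDim Sstar) :
    gibbsBound S Sstar π L β μ σ ≤ oracleBound S Sstar π L β μ σ := by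
  have ht0 : 0 < sigmaBarSq Sstar μ σ := by rw [sigmaBarSq]; positivity
  -- Needed because a real infimum over an empty type takes the default value zero.
  have hne : Nonempty {m : M // 0 < π m} := by
    by_contra h
    rw [not_nonempty_iff, isEmpty_subtype] at h
    have : ∑ m, π m ≤ 0 := Finset.sum_nonpos fun m _ => not_lt.1 (h m)
    linarith
  rw [gibbsBound, oracleBound, neg_mul, neg_mul, mul_assoc, ← mul_neg]
  refine add_le_add_left (mul_le_mul_of_nonneg_left (le_ciInf fun m => ?_) ?_) _
  · exact neg_log_sum_le_term hπ hβ0 ht0 _ _ _ (fun k => by positivity) m.2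
  · have := epsilonN_nonneg n
    linarith

end Estimator

end GibbsMixing

/-! ### Transfer from the standard Gaussian measure to the given probability space. -/

theorem theorem1 {Ω : Type*} [MeasurableSpace Ω] (P : Measure Ω) [IsProbabilityMeasure P]
    (n : ℕ) (hn : 3 ≤ n)
    (μ : GibbsMixing.Vec n) (σ : ℝ) (hσ : 0 < σ)
    (ε : Fin n → Ω → ℝ)
    (hε_indep : iIndepFun ε P)
    (hε_law : ∀ i, HasLaw (ε i) (gaussianReal 0 1) P)
    {M : Type*} [Fintype M]
    (S : M → Submodule ℝ (GibbsMixing.Vec n)) (Sstar : Submodule ℝ (GibbsMixing.Vec n))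
    (hS : ∀ m, S m ≤ Sstar)
    (π : M → ℝ) (hπ_nonneg : ∀ m, 0 ≤ π m) (hπ_sum : ∑ m, π m = 1)
    (L : M → ℝ) (hL : ∀ m, (Module.finrank ℝ (S m) : ℝ) / 2 ≤ L m)
    (β : ℝ) (hβ_pos : 0 < β) (hβ : β < 1 / 4)
    (hN : 2 + Real.log n / GibbsMixing.phi (4 * β) ≤ GibbsMixing.residualDim Sstar) :
    Integrable (fun ω => ‖μ - GibbsMixing.mixedEstimator S Sstar π L β
        (GibbsMixing.observation μ σ (fun i => ε i ω))‖ ^ 2) P ∧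
    ∫ ω, ‖μ - GibbsMixing.mixedEstimator S Sstar π L β
        (GibbsMixing.observation μ σ (fun i => ε i ω))‖ ^ 2 ∂P
      ≤ GibbsMixing.gibbsBound S Sstar π L β μ σ ∧
    GibbsMixing.gibbsBound S Sstar π L β μ σ ≤ GibbsMixing.oracleBound S Sstar π L β μ σ := by
  have hm : AEMeasurable (fun ω i => ε i ω) P :=
    aemeasurable_pi_lambda _ fun i => (hε_law i).aemeasurable
  have hm2 : AEMeasurable (fun ω => (WithLp.toLp 2 fun i => ε i ω : GibbsMixing.Vec n)) P :=
    (show Measurable (WithLp.toLp 2 : (Fin n → ℝ) → GibbsMixing.Vec n) by fun_prop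
      ).comp_aemeasurable hm
  -- Independence makes the joint law a product of one-dimensional Gaussians, which is the standard
  -- Gaussian measure.
  have hlaw : P.map (fun ω => (WithLp.toLp 2 fun i => ε i ω : GibbsMixing.Vec n))
      = stdGaussian (GibbsMixing.Vec n) := by
    have h1 := (iIndepFun_iff_map_fun_eq_pi_map fun i => (hε_law i).aemeasurable).1 hε_indep
    simp_rw [(hε_law _).map_eq] at h1
    rw [← map_pi_eq_stdGaussian, ← h1, AEMeasurable.map_map_of_aemeasurable (by fun_prop) hm]
    rfl
  have hint := GibbsMixing.integrable_norm_sub_mixedEstimator_sq (L := L) (β := β) hS hπ_nonneg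
    hπ_sum μ σ
  have hle := GibbsMixing.integral_norm_sub_mixedEstimator_sq_le hn μ hσ hS hπ_nonneg hπ_sum hL
    hβ_pos hβ hN
  have hN0 : 0 < GibbsMixing.residualDim Sstar := by
    have hlog : 0 ≤ Real.log n := Real.log_natCast_nonneg n
    have hphi : 0 < GibbsMixing.phi (4 * β) := GibbsMixing.phi_pos (by linarith) (by linarith)
    have : 0 ≤ Real.log n / GibbsMixing.phi (4 * β) := by positivity
    linarith
  simp_rw [GibbsMixing.observation_eq]
  rw [← hlaw] at hint hle
  refine ⟨hint.comp_aemeasurable hm2, ?_,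
    GibbsMixing.gibbsBound_le_oracleBound μ hσ hπ_nonneg hπ_sum hβ_pos hN0⟩
  rwa [integral_map hm2 hint.1] at hle
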